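/- Let $d\ge 1$ and let $X_1,X_2,\dots$ be a sequence of zero-mean, uniformly bounded $\mathbb R^d$-valued random vectors on a probability space $(\Omega,\mathcal F,\mathbb P)$. Let $\mathcal F_j=\sigma(X_1,\dots,X_j)$, $\mathcal F_{j,\infty}=\sigma(X_k: k\ge j)$, and $$\alpha(k)=\sup\{|\mathbb P(A\cap B)-\mathbb P(A)\mathbb P(B)|: j\ge1,\ A\in\mathcal F_j,\ B\in\mathcal F_{j+k,\infty}\},$$ $$\phi(k)=\sup\{|\mathbb P(B\mid A)-\mathbb P(B)|: j\ge1,\ A\in\mathcal F_j,\ B\in\mathcal F_{j+k,\infty},\ \mathbb P(A)>0\}.$$ Put $S_n=\sum_{k=1}^n (X_k-\mathbb E[X_k])$, $S_{n,m}=\sum_{j=n}^m X_j$ and $s_n=\min_{|u|=1}\mathrm{Cov}(S_n)u\cdot u$. Assume that: (a) there are $C>0$ and $\delta\in(0,1)$ with $\alpha(n)\le C\delta^n$ for all $n\ge1$, and there is $n_0\ge 1$ with $\phi(n_0)<\tfrac12$; (b) there are constants $C_1,C_2\ge1$ such that for all $1\le n\le m$ with $\|S_{n,m}\|_{L^2}\ge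 C_1$, $$\max_{|u|=1}\mathrm{Cov}(S_{n,m})u\cdot u\le C_2\min_{|u|=1}\mathrm{Cov}(S_{n,m})u\cdot u;$$ (c) $\lim_{n\to\infty}s_n=\infty$. Then there are constants $A_1,A_2>0$ and nonempty disjoint sets $I_j=\{a_j,a_j+1,\dots,b_j\}$, $j=1,2,\dots$, with $b_{j-1}<a_j$ for all $j\ge2$ and with union $\{1,2,\dots\}$, such that for every $j\geq 1$ and every unit vector $u\in\mathbb R^d$ $$A_1\le\Big\|\sum_{k\in I_j}X_k\cdot u\Big\|_{L^2}\le\max_{m\in I_j}\Big\|\sum_{k=a_j}^m X_k\cdot u\Big\|_{L^2}\le A_2 .$$ Moreover, let $k_n=\max\{k\ge 1: b_k\le n\}$ (with $k_n=0$ if $n<b_1$) and $\Xi_j=\sum_{k\in I_j}X_k$. Then: (i) there is a constant $c>0$ such that $\big\|\sum_{k=a}^{b_j}X_k\big\|_{L^2}\le c$ for all $j\ge1$ and all $a\in I_j$; (ii) there are constants $R_1,R_2>0$ such that for all sufficiently large $n$ and all unit vectors $u$, $$R_1k_n\le \mathrm{Var}(S_n\cdot u)=\mathrm{Cov}(S_n)u\cdot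 u\le R_2k_n;$$ (iii) for every $\varepsilon>0$, $$\Big|S_n-\sum_{j=1}^{k_n}\Xi_j\Big|=o(s_n^{\varepsilon})\quad\text{as } n\to\infty,\ \mathbb P\text{-almost surely}.$$ -/

import Mathlib

open MeasureTheory ProbabilityTheory Filter

namespace BlockASIP

noncomputable section

variable {Ω : Type*} {d : ℕ}

/-! Sequences `X₁, X₂, …` are functions on `ℕ`; the value at index `0` is never used. -/

/-- The σ-algebra generated by `X₁, …, X_j`. -/
abbrev pastSigma (X : ℕ → Ω → EuclideanSpace ℝ (Fin d)) (j : ℕ) : MeasurableSpace Ω :=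
  ⨆ k ∈ Set.Icc 1 j, MeasurableSpace.comap (X k) inferInstance

/-- The σ-algebra generated by all `X_k` with `k ≥ j`. -/
abbrev futureSigma (X : ℕ → Ω → EuclideanSpace ℝ (Fin d)) (j : ℕ) : MeasurableSpace Ω :=
  ⨆ k ∈ Set.Ici j, MeasurableSpace.comap (X k) inferInstance

variable [MeasurableSpace Ω]

/-- The strong mixing coefficient `α(k)`. -/
def alphaCoeff (P : Measure Ω) (X : ℕ → Ω → EuclideanSpace ℝ (Fin d)) (k : ℕ) : ℝ :=
  sSup {x : ℝ | ∃ j : ℕ, 1 ≤ j ∧ ∃ A B : Set Ω,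
    MeasurableSet[pastSigma X j] A ∧ MeasurableSet[futureSigma X (j + k)] B ∧
    x = |P.real (A ∩ B) - P.real A * P.real B|}

/-- The mixing coefficient `φ(k)`. -/
def phiCoeff (P : Measure Ω) (X : ℕ → Ω → EuclideanSpace ℝ (Fin d)) (k : ℕ) : ℝ :=
  sSup {x : ℝ | ∃ j : ℕ, 1 ≤ j ∧ ∃ A B : Set Ω,
    MeasurableSet[pastSigma X j] A ∧ MeasurableSet[futureSigma X (j + k)] B ∧
    0 < P A ∧ x = |(ProbabilityTheory.cond P A).real B - P.real B|}

/-- The centred partial sum `S_n = ∑_{k=1}^n (X_k - E X_k)`. -/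
def partialSum (P : Measure Ω) (X : ℕ → Ω → EuclideanSpace ℝ (Fin d)) (n : ℕ) (ω : Ω) :
    EuclideanSpace ℝ (Fin d) :=
  ∑ k ∈ Finset.Icc 1 n, (X k ω - ∫ ω', X k ω' ∂P)

/-- The covariance matrix of a random vector. -/
def covMatrix (P : Measure Ω) (Y : Ω → EuclideanSpace ℝ (Fin d)) : Matrix (Fin d) (Fin d) ℝ :=
  Matrix.of fun i j => covariance (fun ω => Y ω i) (fun ω => Y ω j) P

end

noncomputable section

variable {Ω : Type*} {d : ℕ}

/-- The sum `S_{n,m} = ∑_{j=n}^m X_j`. -/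
def segSum (X : ℕ → Ω → EuclideanSpace ℝ (Fin d)) (n m : ℕ) (ω : Ω) :
    EuclideanSpace ℝ (Fin d) :=
  ∑ j ∈ Finset.Icc n m, X j ω

/-- The quadratic form `V u · u`. -/
def quadForm (V : Matrix (Fin d) (Fin d) ℝ) (u : EuclideanSpace ℝ (Fin d)) : ℝ :=
  inner ℝ (Matrix.toEuclideanLin V u) u

/-- `max_{|u|=1} V u · u` (for `d ≥ 1`; attained by compactness of the sphere). -/
def maxQuad (V : Matrix (Fin d) (Fin d) ℝ) : ℝ :=
  ⨆ u : Metric.sphere (0 : EuclideanSpace ℝ (Fin d)) 1, quadForm V u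

/-- `min_{|u|=1} V u · u` (for `d ≥ 1`; attained by compactness of the sphere). -/
def minQuad (V : Matrix (Fin d) (Fin d) ℝ) : ℝ :=
  ⨅ u : Metric.sphere (0 : EuclideanSpace ℝ (Fin d)) 1, quadForm V u

/-- `s_n = min_{|u|=1} Cov(S_n) u · u`. -/
def minVar [MeasurableSpace Ω] (P : Measure Ω) (X : ℕ → Ω → EuclideanSpace ℝ (Fin d))
    (n : ℕ) : ℝ :=
  minQuad (covMatrix P (partialSum P X n))

/-- There are `C₁, C₂ ≥ 1` such that whenever `‖S_{n,m}‖_{L²} ≥ C₁`, the largest eigenvalue of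
`Cov(S_{n,m})` is at most `C₂` times the smallest one. -/
def ComparableEigenvalues [MeasurableSpace Ω] (P : Measure Ω)
    (X : ℕ → Ω → EuclideanSpace ℝ (Fin d)) : Prop :=
  ∃ C₁ C₂ : ℝ, 1 ≤ C₁ ∧ 1 ≤ C₂ ∧ ∀ n m : ℕ, 1 ≤ n → n ≤ m →
    C₁ ≤ lpNorm (segSum X n m) 2 P →
    maxQuad (covMatrix P (segSum X n m)) ≤ C₂ * minQuad (covMatrix P (segSum X n m))

/-- The sets `I_j = {a_j, …, b_j}`, `j = 1, 2, …`, are nonempty, disjoint, listed from left to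
right, and cover the positive integers. -/
def IsBlockPartition (a b : ℕ → ℕ) : Prop :=
  (∀ j, 1 ≤ j → a j ≤ b j) ∧
  (∀ j, 2 ≤ j → b (j - 1) < a j) ∧
  (∀ i j, 1 ≤ i → 1 ≤ j → i ≠ j → Disjoint (Set.Icc (a i) (b i)) (Set.Icc (a j) (b j))) ∧
  (⋃ j ∈ Set.Ici 1, Set.Icc (a j) (b j)) = Set.Ici 1

/-- `k_n = max {k ≥ 1 : b_k ≤ n}`, with value `0` if there is no such `k`. -/
def blockCount (b : ℕ → ℕ) (n : ℕ) : ℕ :=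
  sSup {k : ℕ | 1 ≤ k ∧ b k ≤ n}

end

end BlockASIP

open BlockASIP Asymptotics

/-!
The blocks are cut greedily, where the `L²` norm of the running sum first reaches a large threshold.
Since `ϕ(n₀) < 1/2`, an Ottaviani type inequality turns `L²` bounds for segment sums into geometric
tails for their maxima over a block, hence into moments of all orders. With four moments, truncation
bounds the covariance of two block sums at distance `k` by `α(k) ^ (1 / 3)`. For neighbouring blocks
the last `ℓ` terms of the first one are split off: they contribute `O(ℓ)` times the size of a block,
which is negligible because the threshold is of order `ℓ ^ 2`. As the eigenvalues of the block
covariances are comparable, in every direction the variance of a sum of `k` blocks is then of order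
`k`, so that `s_n` grows at least linearly in the number of blocks. By Borel–Cantelli the unfinished
block is almost surely `O(log k_n)`.
-/

namespace BlockASIP

section Covariance

variable {Ω : Type*} {m m₁ m₂ mΩ : MeasurableSpace Ω} {P : Measure Ω} {f g : Ω → ℝ}

lemma sq_covariance_le_variance_mul_variance [IsFiniteMeasure P] (hf : MemLp f 2 P)
    (hg : MemLp g 2 P) : cov[f, g; P] ^ 2 ≤ Var[f; P] * Var[g; P] := by
  have hquad (x : ℝ) : 0 ≤ Var[f; P] * (x * x) + 2 * cov[f, g; P] * x + Var[g; P] := by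
    have h := variance_nonneg (x • f + g) P
    rw [variance_add (hf.const_smul x) hg, variance_smul, covariance_smul_left] at h
    linarith
  have h := discrim_le_zero hquad
  rw [discrim] at h
  linarith

lemma abs_covariance_le_mul_of_variance_le_sq [IsFiniteMeasure P] (hf : MemLp f 2 P)
    (hg : MemLp g 2 P) {s t : ℝ} (hs : 0 ≤ s) (ht : 0 ≤ t) (hfs : Var[f; P] ≤ s ^ 2)
    (hgt : Var[g; P] ≤ t ^ 2) : |cov[f, g; P]| ≤ s * t := by
  refine abs_le_of_sq_le_sq ?_ (mul_nonneg hs ht)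
  rw [mul_pow]
  exact (sq_covariance_le_variance_mul_variance hf hg).trans
    (mul_le_mul hfs hgt (variance_nonneg _ _) (sq_nonneg s))

lemma integral_sub_integral_eq_zero [IsProbabilityMeasure P] (f : Ω → ℝ) :
    ∫ ω, (f ω - P[f]) ∂P = 0 := by
  simpa only [average_eq_integral] using integral_sub_average P f

lemma covariance_eq_integral_mul_sub [IsProbabilityMeasure P] (hg : Integrable g P)
    (hfg : Integrable (fun ω => f ω * (g ω - P[g])) P) :
    cov[f, g; P] = ∫ ω, f ω * (g ω - P[g]) ∂P := by
  have hg₀ : Integrable (fun ω => g ω - P[g]) P := hg.sub (integrable_const _)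
  simp only [covariance, sub_mul]
  rw [integral_sub hfg (hg₀.const_mul _), integral_const_mul, integral_sub_integral_eq_zero g,
    mul_zero, sub_zero]

lemma covariance_indicator_one_left [IsProbabilityMeasure P] {A : Set Ω} (hA : MeasurableSet A)
    (hg : Integrable g P) :
    cov[A.indicator 1, g; P] = ∫ ω in A, (g ω - P[g]) ∂P := by
  have hmul : (fun ω => A.indicator 1 ω * (g ω - P[g])) = A.indicator fun ω => g ω - P[g] := by
    ext ω
    by_cases h : ω ∈ A <;> simp [h]
  rw [covariance_eq_integral_mul_sub hg, hmul, integral_indicator hA]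
  rw [hmul]
  exact (hg.sub (integrable_const _)).indicator hA

lemma covariance_indicator_one [IsProbabilityMeasure P] {A B : Set Ω} (hA : MeasurableSet A)
    (hB : MeasurableSet B) :
    cov[A.indicator 1, B.indicator 1; P] = P.real (A ∩ B) - P.real A * P.real B := by
  have hmemLp {E : Set Ω} (hE : MeasurableSet E) : MemLp (E.indicator (1 : Ω → ℝ)) 2 P :=
    memLp_indicator_const 2 hE 1 (.inr (measure_ne_top P E))
  rw [covariance_eq_sub (hmemLp hA) (hmemLp hB), ← Set.inter_indicator_one,
    integral_indicator_one hA, integral_indicator_one hB, integral_indicator_one (hA.inter hB)]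

lemma integral_abs_eq_two_mul_setIntegral_of_integral_eq_zero (hf : Integrable f P)
    (hmean : P[f] = 0) : ∫ ω, |f ω| ∂P = 2 * ∫ ω in {ω | 0 ≤ f ω}, f ω ∂P := by
  have hA : NullMeasurableSet {ω | 0 ≤ f ω} P :=
    aestronglyMeasurable_const.nullMeasurableSet_le hf.aestronglyMeasurable
  have habs (ω : Ω) : |f ω| = 2 * {ω | 0 ≤ f ω}.indicator f ω - f ω := by
    rcases le_or_gt 0 (f ω) with h | h
    · rw [Set.indicator_of_mem (s := {ω | 0 ≤ f ω}) h, abs_of_nonneg h]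
      ring
    · rw [Set.indicator_of_notMem (s := {ω | 0 ≤ f ω}) h.not_ge, abs_of_neg h]
      ring
  simp only [habs]
  rw [integral_sub ((hf.indicator₀ hA).const_mul 2) hf, integral_const_mul, integral_indicator₀ hA,
    hmean, sub_zero]

-- With `h = E[g - E g | m]` the covariance is `∫ f h`, at most `S ∫ |h|`, and `∫ |h|` is twice the
-- integral of `h` over `A = {0 ≤ h}` because `h` has mean zero.
lemma exists_abs_covariance_le_covariance_indicator [IsProbabilityMeasure P] (hm : m ≤ mΩ)
    (hf : StronglyMeasurable[m] f) {S : ℝ} (hfS : ∀ᵐ ω ∂P, |f ω| ≤ S) (hg : Integrable g P) :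
    ∃ A, MeasurableSet[m] A ∧ |cov[f, g; P]| ≤ 2 * S * cov[A.indicator 1, g; P] := by
  set g₀ : Ω → ℝ := fun ω => g ω - P[g]
  set h : Ω → ℝ := P[g₀|m]
  have hg₀ : Integrable g₀ P := hg.sub (integrable_const _)
  have hmean : P[h] = 0 := (integral_condExp hm).trans (integral_sub_integral_eq_zero g)
  have hfg₀ : Integrable (fun ω => f ω * g₀ ω) P :=
    hg₀.bdd_mul (hf.mono hm).aestronglyMeasurable hfS
  have hcov : cov[f, g; P] = ∫ ω, f ω * h ω ∂P := by
    rw [covariance_eq_integral_mul_sub hg hfg₀, ← integral_condExp hm]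
    exact integral_congr_ae (condExp_stronglyMeasurable_mul_of_bound hm hf hg₀ S hfS)
  have hA : MeasurableSet[m] {ω | 0 ≤ h ω} :=
    stronglyMeasurable_const.measurableSet_le stronglyMeasurable_condExp
  have hint : ∫ ω, |h ω| ∂P = 2 * ∫ ω in {ω | 0 ≤ h ω}, h ω ∂P :=
    integral_abs_eq_two_mul_setIntegral_of_integral_eq_zero integrable_condExp hmean
  refine ⟨_, hA, ?_⟩
  calc |cov[f, g; P]| ≤ ∫ ω, S * |h ω| ∂P := by
        rw [hcov, ← Real.norm_eq_abs]
        refine norm_integral_le_of_norm_le (integrable_condExp.abs.const_mul S) ?_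
        filter_upwards [hfS] with ω hω
        rw [Real.norm_eq_abs, abs_mul]
        exact mul_le_mul_of_nonneg_right hω (abs_nonneg _)
    _ = 2 * S * cov[{ω | 0 ≤ h ω}.indicator 1, g; P] := by
        rw [integral_const_mul, hint, covariance_indicator_one_left (hm _ hA) hg,
          setIntegral_condExp hm hg₀ hA]
        ring

lemma abs_covariance_le_of_bounded [IsProbabilityMeasure P] (hm₁ : m₁ ≤ mΩ) (hm₂ : m₂ ≤ mΩ) {α : ℝ}
    (hα : ∀ A B, MeasurableSet[m₁] A → MeasurableSet[m₂] B →
      |P.real (A ∩ B) - P.real A * P.real B| ≤ α)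
    (hf : StronglyMeasurable[m₁] f) (hg : StronglyMeasurable[m₂] g) {S T : ℝ} (hS : 0 ≤ S)
    (hT : 0 ≤ T) (hfS : ∀ᵐ ω ∂P, |f ω| ≤ S) (hgT : ∀ᵐ ω ∂P, |g ω| ≤ T) :
    |cov[f, g; P]| ≤ 4 * S * T * α := by
  have hgi : Integrable g P := .of_bound (hg.mono hm₂).aestronglyMeasurable T hgT
  obtain ⟨A, hA, hfA⟩ := exists_abs_covariance_le_covariance_indicator hm₁ hf hfS hgi
  have hAi : Integrable (A.indicator (1 : Ω → ℝ)) P := (integrable_const 1).indicator (hm₁ A hA)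
  obtain ⟨B, hB, hgB⟩ := exists_abs_covariance_le_covariance_indicator hm₂ hg hgT hAi
  calc |cov[f, g; P]| ≤ 2 * S * cov[A.indicator 1, g; P] := hfA
    _ ≤ 2 * S * (2 * T * cov[B.indicator 1, A.indicator 1; P]) := by
        gcongr
        exact (le_abs_self _).trans (covariance_comm g _ ▸ hgB)
    _ ≤ 2 * S * (2 * T * α) := by
        gcongr
        rw [covariance_comm, covariance_indicator_one (hm₁ A hA) (hm₂ B hB)]
        exact (le_abs_self _).trans (hα A B hA hB)
    _ = 4 * S * T * α := by ring

/-- The constant `∑ (k + 1)^p r^k`, bounding the `p`-th moment of a variable with tail `r^k` at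
the integers `k`. -/
noncomputable def geomMoment (p : ℕ) (r : ℝ) : ℝ := ∑' k : ℕ, ((k : ℝ) + 1) ^ p * r ^ k

lemma summable_geomMoment (p : ℕ) {r : ℝ} (hr₀ : 0 ≤ r) (hr₁ : r < 1) :
    Summable fun k : ℕ => ((k : ℝ) + 1) ^ p * r ^ k := by
  rcases hr₀.eq_or_lt with rfl | hr
  · exact summable_of_ne_finset_zero (s := {0}) fun k hk => by
      rw [zero_pow (by simpa using hk), mul_zero]
  have h := (summable_nat_add_iff 1).2 (summable_pow_mul_geometric_of_norm_lt_one (R := ℝ) p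
    (by rwa [Real.norm_of_nonneg hr₀]))
  refine (h.mul_left r⁻¹).congr fun k => ?_
  rw [pow_succ, Nat.cast_add_one]
  field_simp

lemma one_le_geomMoment (p : ℕ) {r : ℝ} (hr₀ : 0 ≤ r) (hr₁ : r < 1) : 1 ≤ geomMoment p r := by
  refine le_trans (by simp) ((summable_geomMoment p hr₀ hr₁).le_tsum 0 fun k _ => by positivity)

lemma exists_nat_mul_lt_le_add_one_mul {x W : ℝ} (hx : 0 < x) (hW : 0 < W) :
    ∃ k : ℕ, k * W < x ∧ x ≤ (k + 1) * W := by
  obtain ⟨k, hk⟩ := Nat.exists_eq_add_one_of_ne_zero (Nat.ceil_pos.2 (div_pos hx hW)).ne'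
  refine ⟨k, (lt_div_iff₀ hW).1 (Nat.lt_ceil.1 (hk ▸ k.lt_succ_self)), (div_le_iff₀ hW).1 ?_⟩
  exact_mod_cast hk ▸ Nat.le_ceil (x / W)

theorem integral_abs_pow_le_geomMoment_mul [IsFiniteMeasure P] (hf : Measurable f) {W r : ℝ}
    (hW : 0 < W) (hr₀ : 0 ≤ r) (hr₁ : r < 1) {p : ℕ} (hp : p ≠ 0)
    (htail : ∀ k : ℕ, P.real {ω | k * W < |f ω|} ≤ r ^ k) :
    ∫ ω, |f ω| ^ p ∂P ≤ geomMoment p r * W ^ p := by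
  have hE (k : ℕ) : MeasurableSet {ω | k * W < |f ω|} := measurableSet_lt measurable_const hf.abs
  have hlayer (ω : Ω) : ENNReal.ofReal (|f ω| ^ p) ≤ ∑' k : ℕ,
      {ω | k * W < |f ω|}.indicator (fun _ => ENNReal.ofReal (((k + 1) * W) ^ p)) ω := by
    rcases (abs_nonneg (f ω)).eq_or_lt with h | h
    · simp [← h, hp]
    obtain ⟨k, hk_lt, hk_le⟩ := exists_nat_mul_lt_le_add_one_mul h hW
    refine le_trans ?_ (ENNReal.le_tsum k)
    rw [Set.indicator_of_mem (by exact hk_lt)]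
    gcongr
  have hsum : ∫⁻ ω, ENNReal.ofReal (|f ω| ^ p) ∂P ≤ ENNReal.ofReal (geomMoment p r * W ^ p) := calc
    _ ≤ ∑' k : ℕ, ENNReal.ofReal (((k + 1) * W) ^ p) * P {ω | k * W < |f ω|} := by
        refine (lintegral_mono hlayer).trans_eq ?_
        rw [lintegral_tsum fun k => (measurable_const.indicator (hE k)).aemeasurable]
        exact tsum_congr fun k => lintegral_indicator_const (hE k) _
    _ ≤ ∑' k : ℕ, ENNReal.ofReal (((k : ℝ) + 1) ^ p * r ^ k * W ^ p) := by
        refine ENNReal.tsum_le_tsum fun k => ?_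
        rw [← ofReal_measureReal, ← ENNReal.ofReal_mul (by positivity), mul_pow, mul_right_comm]
        gcongr
        exact htail k
    _ = ENNReal.ofReal (geomMoment p r * W ^ p) := by
        rw [← ENNReal.ofReal_tsum_of_nonneg (fun k => by positivity)
          ((summable_geomMoment p hr₀ hr₁).mul_right _), tsum_mul_right, geomMoment]
  have hκ := one_le_geomMoment p hr₀ hr₁
  rw [integral_eq_lintegral_of_nonneg_ae (ae_of_all _ fun ω => by positivity)
    (hf.abs.pow_const p).aestronglyMeasurable]
  exact ENNReal.toReal_le_of_le_ofReal (by positivity) hsum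

lemma integrable_pow_four (hf : MemLp f 4 P) : Integrable (fun ω => f ω ^ 4) P :=
  (hf.integrable_norm_pow (p := 4) four_ne_zero).congr
    (ae_of_all _ fun ω => Even.pow_abs (by decide) (f ω))

lemma variance_le_of_integral_pow_four_le [IsProbabilityMeasure P] (hf : MemLp f 4 P)
    (hg : AEStronglyMeasurable g P) (hgf : ∀ ω, |g ω| ≤ |f ω|) {M : ℝ} (hM : 0 < M)
    (hfM : ∫ ω, f ω ^ 4 ∂P ≤ M ^ 4) : Var[g; P] ≤ M ^ 2 := by
  have hf4 := integrable_pow_four hf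
  have hle (ω : Ω) : g ω ^ 2 ≤ (f ω ^ 4 / M ^ 2 + M ^ 2) / 2 := by
    have hAMGM := two_mul_le_add_sq (f ω ^ 2 / M) M
    have hmul : f ω ^ 2 / M * M = f ω ^ 2 := div_mul_cancel₀ _ hM.ne'
    have hpow : (f ω ^ 2 / M) ^ 2 = f ω ^ 4 / M ^ 2 := by rw [div_pow, ← pow_mul]
    linarith [sq_le_sq.2 (hgf ω)]
  calc Var[g; P] ≤ ∫ ω, g ω ^ 2 ∂P := variance_le_expectation_sq hg
    _ ≤ ∫ ω, (f ω ^ 4 / M ^ 2 + M ^ 2) / 2 ∂P :=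
        integral_mono_of_nonneg (ae_of_all _ fun ω => sq_nonneg _)
          (((hf4.div_const _).add (integrable_const _)).div_const _) (ae_of_all _ hle)
    _ = ((∫ ω, f ω ^ 4 ∂P) / M ^ 2 + M ^ 2) / 2 := by
        rw [integral_div, integral_add (hf4.div_const _) (integrable_const _), integral_div,
          integral_const, probReal_univ, one_smul]
    _ ≤ (M ^ 4 / M ^ 2 + M ^ 2) / 2 := by gcongr
    _ = M ^ 2 := by field_simp; ring

lemma variance_sub_truncation_le [IsProbabilityMeasure P] (hf : MemLp f 4 P) {T : ℝ} (hT : 0 < T) :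
    Var[f - truncation f T; P] ≤ (∫ ω, f ω ^ 4 ∂P) / T ^ 2 := by
  have hf4 := integrable_pow_four hf
  have hle (ω : Ω) : (f ω - truncation f T ω) ^ 2 ≤ f ω ^ 4 / T ^ 2 := by
    rcases lt_or_ge |f ω| T with h | h
    · rw [truncation_eq_self h, sub_self, zero_pow two_ne_zero]
      exact div_nonneg (Even.pow_nonneg (by decide) _) (sq_nonneg T)
    have hrem : |f ω - truncation f T ω| ≤ |f ω| := by
      simp only [truncation, Function.comp_apply, Set.indicator, id]
      split_ifs <;> simp
    have hT_le : T ^ 2 ≤ f ω ^ 2 := sq_le_sq.2 ((abs_of_pos hT).trans_le h)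
    calc (f ω - truncation f T ω) ^ 2 ≤ f ω ^ 2 := sq_le_sq.2 hrem
      _ ≤ f ω ^ 4 / T ^ 2 := by
        rw [le_div_iff₀ (by positivity)]
        nlinarith [sq_nonneg (f ω)]
  rw [← integral_div]
  exact (variance_le_expectation_sq (hf.1.sub hf.1.truncation)).trans
    (integral_mono_of_nonneg (ae_of_all _ fun ω => sq_nonneg _) (hf4.div_const _)
      (ae_of_all _ hle))

lemma abs_covariance_truncation_le [IsProbabilityMeasure P] (hm₁ : m₁ ≤ mΩ) (hm₂ : m₂ ≤ mΩ) {α : ℝ}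
    (hα : ∀ A B, MeasurableSet[m₁] A → MeasurableSet[m₂] B →
      |P.real (A ∩ B) - P.real A * P.real B| ≤ α)
    (hf : StronglyMeasurable[m₁] f) (hg : StronglyMeasurable[m₂] g) {T : ℝ} (hT : 0 ≤ T) :
    |cov[truncation f T, truncation g T; P]| ≤ 4 * T * T * α := by
  have hτ : Measurable ((Set.Ioc (-T) T).indicator id) := measurable_id.indicator measurableSet_Ioc
  have hτT (h : Ω → ℝ) : ∀ᵐ ω ∂P, |truncation h T ω| ≤ T :=
    ae_of_all _ fun ω => (abs_truncation_le_bound h T ω).trans_eq (abs_of_nonneg hT)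
  exact abs_covariance_le_of_bounded hm₁ hm₂ hα
    (hτ.comp hf.measurable).stronglyMeasurable (hτ.comp hg.measurable).stronglyMeasurable
    hT hT (hτT f) (hτT g)

theorem abs_covariance_le_of_integral_pow_four_le [IsProbabilityMeasure P] (hm₁ : m₁ ≤ mΩ)
    (hm₂ : m₂ ≤ mΩ) {η : ℝ} (hη : 0 < η)
    (hα : ∀ A B, MeasurableSet[m₁] A → MeasurableSet[m₂] B →
      |P.real (A ∩ B) - P.real A * P.real B| ≤ η ^ 3)
    (hf : StronglyMeasurable[m₁] f) (hg : StronglyMeasurable[m₂] g) (hf4 : MemLp f 4 P)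
    (hg4 : MemLp g 4 P) {M : ℝ} (hM : 0 < M) (hfM : ∫ ω, f ω ^ 4 ∂P ≤ M ^ 4)
    (hgM : ∫ ω, g ω ^ 4 ∂P ≤ M ^ 4) : |cov[f, g; P]| ≤ 6 * M ^ 2 * η := by
  set T := M / η
  have hT : 0 < T := div_pos hM hη
  have hf' := (hf.mono hm₁).aestronglyMeasurable (μ := P)
  have hg' := (hg.mono hm₂).aestronglyMeasurable (μ := P)
  have hf2 : MemLp f 2 P := hf4.mono_exponent (by norm_num)
  have hg2 : MemLp g 2 P := hg4.mono_exponent (by norm_num)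
  have hτf : MemLp (truncation f T) 2 P := hf'.memLp_truncation
  have hτg : MemLp (truncation g T) 2 P := hg'.memLp_truncation
  have hrem {h : Ω → ℝ} (hh : MemLp h 4 P) (hhM : ∫ ω, h ω ^ 4 ∂P ≤ M ^ 4) :
      Var[h - truncation h T; P] ≤ (M * η) ^ 2 := by
    refine (variance_sub_truncation_le hh hT).trans
      ((div_le_div_of_nonneg_right hhM ?_).trans_eq ?_)
    · positivity
    · simp only [T]
      field_simp
  have hright : |cov[truncation f T, g - truncation g T; P]| ≤ M * (M * η) :=
    abs_covariance_le_mul_of_variance_le_sq hτf (hg2.sub hτg) hM.le (by positivity)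
      (variance_le_of_integral_pow_four_le hf4 hf'.truncation (abs_truncation_le_abs_self f T)
        hM hfM)
      (hrem hg4 hgM)
  have hleft : |cov[f - truncation f T, g; P]| ≤ M * η * M :=
    abs_covariance_le_mul_of_variance_le_sq (hf2.sub hτf) hg2 (by positivity) hM.le (hrem hf4 hfM)
      (variance_le_of_integral_pow_four_le hg4 hg' (fun _ => le_rfl) hM hgM)
  have hsplit : cov[f, g; P] = cov[truncation f T, truncation g T; P]
      + cov[truncation f T, g - truncation g T; P] + cov[f - truncation f T, g; P] := by
    rw [covariance_sub_left hf2 hτf hg2, covariance_sub_right hτf hg2 hτg]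
    ring
  have hTη : 4 * T * T * η ^ 3 = 4 * M ^ 2 * η := by
    simp only [T]
    field_simp
  have hbdd := abs_covariance_truncation_le hm₁ hm₂ hα hf hg hT.le
  rw [hsplit]
  refine (abs_add_three _ _ _).trans ?_
  linarith

end Covariance

section Variance

variable {Ω : Type*} [MeasurableSpace Ω] {P : Measure Ω} [IsFiniteMeasure P] {f g : Ω → ℝ}

lemma variance_add_le_two_mul_add (hf : MemLp f 2 P) (hg : MemLp g 2 P) :
    Var[f + g; P] ≤ 2 * Var[f; P] + 2 * Var[g; P] := by
  have h := variance_nonneg (f - g) P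
  rw [variance_sub hf hg] at h
  rw [variance_add hf hg]
  linarith

lemma half_variance_sub_le_variance_add (hf : MemLp f 2 P) (hg : MemLp g 2 P) :
    Var[f; P] / 2 - Var[g; P] ≤ Var[f + g; P] := by
  have h := variance_add_le_two_mul_add (hf.add hg) hg.neg
  rw [add_neg_cancel_right, variance_neg] at h
  linarith

theorem abs_variance_sum_sub_sum_variance_le {Z : ℕ → Ω → ℝ} (hZ : ∀ j, MemLp (Z j) 2 P)
    {β : ℕ → ℝ} {s : ℝ} (hβs : ∀ n, ∑ q ∈ Finset.range n, β q ≤ s)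
    (hcov : ∀ i q, |cov[Z i, Z (i + q + 1); P]| ≤ β q) (k : ℕ) :
    |Var[fun ω => ∑ j ∈ Finset.range k, Z j ω; P] - ∑ j ∈ Finset.range k, Var[Z j; P]|
      ≤ 2 * s * k := by
  induction k with
  | zero => simp [variance_zero, ← Pi.zero_def]
  | succ k ih =>
    have hsum : MemLp (fun ω => ∑ j ∈ Finset.range k, Z j ω) 2 P :=
      memLp_finsetSum _ fun j _ => hZ j
    have hcross : |∑ j ∈ Finset.range k, cov[Z j, Z k; P]| ≤ s := by
      refine (Finset.abs_sum_le_sum_abs _ _).trans (le_trans ?_ (hβs k))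
      rw [← Finset.sum_range_reflect β]
      refine Finset.sum_le_sum fun j hj => ?_
      have hjk := Finset.mem_range.1 hj
      have h := hcov j (k - 1 - j)
      rwa [show j + (k - 1 - j) + 1 = k by omega] at h
    simp_rw [Finset.sum_range_succ]
    rw [variance_fun_add hsum (hZ k), covariance_fun_sum_left' (fun j _ => hZ j) (hZ k)]
    rw [abs_le] at ih hcross ⊢
    push_cast
    constructor <;> linarith [ih.1, ih.2, hcross.1, hcross.2]

end Variance

section BorelCantelli

variable {Ω : Type*} [MeasurableSpace Ω] {P : Measure Ω} [IsFiniteMeasure P]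

lemma pow_ceil_log_le {r : ℝ} (hr₀ : 0 < r) (hr₁ : r < 1) {x : ℝ} (hx : 0 < x) :
    r ^ ⌈2 / -Real.log r * Real.log x⌉₊ ≤ 1 / x ^ 2 := by
  have hlog : 0 < -Real.log r := neg_pos.2 (Real.log_neg hr₀ hr₁)
  rw [← Real.log_le_log_iff (by positivity) (by positivity), Real.log_pow, one_div, Real.log_inv,
    Real.log_pow, le_neg, ← mul_neg, ← div_le_iff₀ hlog, Nat.cast_two, mul_div_right_comm]
  exact Nat.le_ceil _

theorem ae_eventually_notMem_of_measureReal_le_pow {E : ℕ → ℕ → Set Ω} {r : ℝ} (hr₀ : 0 < r)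
    (hr₁ : r < 1) (hE : ∀ j k, P.real (E j k) ≤ r ^ k) :
    ∀ᵐ ω ∂P, ∀ᶠ j : ℕ in atTop, ω ∉ E j ⌈2 / -Real.log r * Real.log (j + 1)⌉₊ := by
  have hsum : Summable fun j : ℕ => 1 / ((j : ℝ) + 1) ^ 2 := by
    exact_mod_cast (summable_nat_add_iff 1).2 (Real.summable_one_div_nat_pow.2 one_lt_two)
  refine ae_eventually_notMem (ne_top_of_le_ne_top hsum.tsum_ofReal_ne_top
    (ENNReal.tsum_le_tsum fun j => ?_))
  rw [← ofReal_measureReal]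
  exact ENNReal.ofReal_le_ofReal ((hE j _).trans (pow_ceil_log_le hr₀ hr₁ (by positivity)))

lemma isLittleO_ceil_mul_log_rpow (c : ℝ) {ε : ℝ} (hε : 0 < ε) :
    (fun k : ℕ => (⌈c * Real.log (k + 1)⌉₊ : ℝ)) =o[atTop] fun k : ℕ => ((k : ℝ) + 1) ^ ε := by
  have hshift : Tendsto (fun k : ℕ => (k : ℝ) + 1) atTop atTop :=
    tendsto_atTop_add_const_right _ _ tendsto_natCast_atTop_atTop
  have hlog : (fun k : ℕ => c * Real.log (k + 1)) =o[atTop] fun k : ℕ => ((k : ℝ) + 1) ^ ε :=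
    ((isLittleO_log_rpow_atTop hε).comp_tendsto hshift).const_mul_left c
  have hone : (fun _ : ℕ => (1 : ℝ)) =o[atTop] fun k : ℕ => ((k : ℝ) + 1) ^ ε :=
    isLittleO_const_left.2
      (.inr (tendsto_norm_atTop_atTop.comp ((tendsto_rpow_atTop hε).comp hshift)))
  refine IsBigO.trans_isLittleO (.of_norm_le fun k => ?_) (hlog.norm_left.add hone)
  rw [Real.norm_natCast, Real.norm_eq_abs]
  calc (⌈c * Real.log (k + 1)⌉₊ : ℝ) ≤ ⌈|c * Real.log (k + 1)|⌉₊ := by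
        exact_mod_cast Nat.ceil_mono (le_abs_self _)
    _ ≤ |c * Real.log (k + 1)| + 1 := (Nat.ceil_lt_add_one (abs_nonneg _)).le

end BorelCantelli

section SegmentSums

variable {Ω : Type*} {d : ℕ} {X : ℕ → Ω → EuclideanSpace ℝ (Fin d)}

lemma segSum_of_lt {n m : ℕ} (h : m < n) : segSum X n m = 0 := by
  ext1 ω
  simp [segSum, Finset.Icc_eq_empty_of_lt h]

lemma segSum_self (n : ℕ) : segSum X n n = X n := by
  ext1 ω
  simp [segSum]

lemma segSum_add_segSum {a m r : ℕ} (h₁ : a ≤ m + 1) (h₂ : m ≤ r) (ω : Ω) :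
    segSum X a m ω + segSum X (m + 1) r ω = segSum X a r ω := by
  have := Finset.sum_Ico_consecutive (fun k => X k ω) h₁ (show m + 1 ≤ r + 1 by lia)
  simpa only [segSum, ← Finset.Ico_add_one_right_eq_Icc] using this

lemma segSum_succ {a m : ℕ} (h : a ≤ m + 1) (ω : Ω) :
    segSum X a (m + 1) ω = segSum X a m ω + X (m + 1) ω := by
  rw [← segSum_add_segSum h m.le_succ, segSum_self]

lemma norm_segSum_le {L : ℝ} {ω : Ω} (hL : ∀ k, 1 ≤ k → ‖X k ω‖ ≤ L) {a b : ℕ} (ha : 1 ≤ a) :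
    ‖segSum X a b ω‖ ≤ ((b + 1 - a : ℕ) : ℝ) * L := by
  have := norm_sum_le_of_le (Finset.Icc a b) (f := fun k => X k ω) (n := fun _ => L)
    fun k hk => hL k (ha.trans (Finset.mem_Icc.1 hk).1)
  simpa [segSum] using this

lemma norm_segSum_sub_segSum_sub_segSum_le {L : ℝ} {ω : Ω} (hL : ∀ k, 1 ≤ k → ‖X k ω‖ ≤ L)
    {a m r n : ℕ} (hn : 1 ≤ n) (h₁ : a ≤ m + 1) (h₂ : m ≤ r) :
    ‖segSum X a r ω - segSum X a m ω - segSum X (m + n) r ω‖ ≤ n * L := by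
  have hL₀ : 0 ≤ L := (norm_nonneg _).trans (hL 1 le_rfl)
  rw [← segSum_add_segSum h₁ h₂ ω, add_sub_cancel_left]
  rcases lt_or_ge r (m + n) with hr | hr
  · rw [segSum_of_lt hr, Pi.zero_apply, sub_zero]
    refine (norm_segSum_le hL m.succ_pos).trans ?_
    gcongr
    lia
  · obtain ⟨n, rfl⟩ := Nat.exists_eq_add_of_le' hn
    rw [← segSum_add_segSum (X := X) (m := m + n) (by lia) (by lia) ω, ← add_assoc,
      add_sub_cancel_right]
    refine (norm_segSum_le hL m.succ_pos).trans ?_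
    gcongr
    lia

lemma measurable_pastSigma {j k : ℕ} (hk : 1 ≤ k) (hkj : k ≤ j) :
    Measurable[pastSigma X j] (X k) :=
  Measurable.mono (comap_measurable (X k))
    (le_iSup₂_of_le (f := fun k (_ : k ∈ Set.Icc 1 j) =>
      MeasurableSpace.comap (X k) inferInstance) k ⟨hk, hkj⟩ le_rfl) le_rfl

lemma measurable_futureSigma {j k : ℕ} (hjk : j ≤ k) :
    Measurable[futureSigma X j] (X k) :=
  Measurable.mono (comap_measurable (X k))
    (le_iSup₂_of_le (f := fun k (_ : k ∈ Set.Ici j) =>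
      MeasurableSpace.comap (X k) inferInstance) k hjk le_rfl) le_rfl

lemma measurable_segSum_pastSigma {a b j : ℕ} (ha : 1 ≤ a) (hb : b ≤ j) :
    Measurable[pastSigma X j] (segSum X a b) := by
  unfold segSum
  exact Finset.measurable_fun_sum (m := pastSigma X j) _ fun k hk =>
    measurable_pastSigma (ha.trans (Finset.mem_Icc.1 hk).1) ((Finset.mem_Icc.1 hk).2.trans hb)

lemma measurable_segSum_futureSigma {a b j : ℕ} (ha : j ≤ a) :
    Measurable[futureSigma X j] (segSum X a b) := by
  unfold segSum
  exact Finset.measurable_fun_sum (m := futureSigma X j) _ fun k hk =>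
    measurable_futureSigma (ha.trans (Finset.mem_Icc.1 hk).1)

lemma pastSigma_le [mΩ : MeasurableSpace Ω] (hX : ∀ k, 1 ≤ k → Measurable (X k)) (j : ℕ) :
    pastSigma X j ≤ mΩ :=
  iSup₂_le fun k hk => (hX k hk.1).comap_le

lemma futureSigma_le [mΩ : MeasurableSpace Ω] (hX : ∀ k, 1 ≤ k → Measurable (X k)) {j : ℕ}
    (hj : 1 ≤ j) : futureSigma X j ≤ mΩ :=
  iSup₂_le fun k hk => (hX k (hj.trans hk)).comap_le

lemma measurable_segSum [MeasurableSpace Ω] (hX : ∀ k, 1 ≤ k → Measurable (X k)) {a b : ℕ}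
    (ha : 1 ≤ a) : Measurable (segSum X a b) :=
  (measurable_segSum_futureSigma le_rfl).mono (futureSigma_le hX ha) le_rfl

end SegmentSums

section MixingCoefficients

variable {Ω : Type*} [MeasurableSpace Ω] {P : Measure Ω} [IsProbabilityMeasure P] {d : ℕ}
  {X : ℕ → Ω → EuclideanSpace ℝ (Fin d)}

lemma abs_sub_le_alphaCoeff {j k : ℕ} (hj : 1 ≤ j) {A B : Set Ω}
    (hA : MeasurableSet[pastSigma X j] A) (hB : MeasurableSet[futureSigma X (j + k)] B) :
    |P.real (A ∩ B) - P.real A * P.real B| ≤ alphaCoeff P X k := by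
  refine le_csSup ⟨1, ?_⟩ ⟨j, hj, A, B, hA, hB, rfl⟩
  rintro x ⟨j, -, A, B, -, -, rfl⟩
  exact abs_sub_le_of_nonneg_of_le measureReal_nonneg measureReal_le_one (by positivity)
    (mul_le_one₀ measureReal_le_one measureReal_nonneg measureReal_le_one)

lemma abs_cond_sub_le_phiCoeff {j k : ℕ} (hj : 1 ≤ j) {A B : Set Ω}
    (hA : MeasurableSet[pastSigma X j] A) (hB : MeasurableSet[futureSigma X (j + k)] B)
    (hA₀ : 0 < P A) : |P[|A].real B - P.real B| ≤ phiCoeff P X k := by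
  refine le_csSup ⟨1, ?_⟩ ⟨j, hj, A, B, hA, hB, hA₀, rfl⟩
  rintro x ⟨j, -, A, B, -, -, hA₀, rfl⟩
  have := cond_isProbabilityMeasure (μ := P) hA₀.ne'
  exact abs_sub_le_of_nonneg_of_le measureReal_nonneg measureReal_le_one measureReal_nonneg
    measureReal_le_one

lemma abs_sub_le_phiCoeff_mul (hX : ∀ k, 1 ≤ k → Measurable (X k)) {j k : ℕ} (hj : 1 ≤ j)
    {A B : Set Ω} (hA : MeasurableSet[pastSigma X j] A)
    (hB : MeasurableSet[futureSigma X (j + k)] B) :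
    |P.real (A ∩ B) - P.real A * P.real B| ≤ phiCoeff P X k * P.real A := by
  rcases eq_or_ne (P A) 0 with hA₀ | hA₀
  · simp [Measure.real, hA₀, measure_mono_null Set.inter_subset_left hA₀]
  · have hpos : 0 < P.real A := ENNReal.toReal_pos hA₀ (measure_ne_top _ _)
    have hcond := abs_cond_sub_le_phiCoeff hj hA hB (pos_iff_ne_zero.2 hA₀)
    rw [measureReal_def, cond_apply (pastSigma_le hX j A hA), ENNReal.toReal_mul,
      ENNReal.toReal_inv, ← measureReal_def, ← measureReal_def] at hcond
    calc |P.real (A ∩ B) - P.real A * P.real B|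
        = |(P.real A)⁻¹ * P.real (A ∩ B) - P.real B| * P.real A := by
          rw [← abs_of_pos hpos, ← abs_mul, abs_of_pos hpos]
          congr 1
          field_simp
      _ ≤ phiCoeff P X k * P.real A := by gcongr

end MixingCoefficients

section BoundedProcesses

/-- `X₁, X₂, …` are measurable and almost surely bounded by `L`; nothing is asked of `X₀`. -/
structure IsBoundedProcess {Ω : Type*} [MeasurableSpace Ω] (P : Measure Ω) {d : ℕ}
    (X : ℕ → Ω → EuclideanSpace ℝ (Fin d)) (L : ℝ) : Prop where
  measurable : ∀ k, 1 ≤ k → Measurable (X k)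
  ae_norm_le : ∀ᵐ ω ∂P, ∀ k, 1 ≤ k → ‖X k ω‖ ≤ L

/-- All segment sums inside `[a, b]` have `L²` norm at most `D`. -/
def SegBound {Ω : Type*} [MeasurableSpace Ω] (P : Measure Ω) {d : ℕ}
    (X : ℕ → Ω → EuclideanSpace ℝ (Fin d)) (D : ℝ) (a b : ℕ) : Prop :=
  ∀ i j, a ≤ i → j ≤ b → lpNorm (segSum X i j) 2 P ≤ D

variable {Ω : Type*} [MeasurableSpace Ω] {P : Measure Ω} {d : ℕ}
  {X : ℕ → Ω → EuclideanSpace ℝ (Fin d)} {L D : ℝ}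

lemma SegBound.mono {a b a' b' : ℕ} (h : SegBound P X D a b) (ha : a ≤ a') (hb : b' ≤ b) :
    SegBound P X D a' b' :=
  fun i j hi hj => h i j (ha.trans hi) (hj.trans hb)

lemma sq_lpNorm_two_eq {E : Type*} [NormedAddCommGroup E] {f : Ω → E}
    (hf : AEStronglyMeasurable f P) : lpNorm f 2 P ^ 2 = ∫ ω, ‖f ω‖ ^ 2 ∂P := by
  have h₀ : 0 ≤ ∫ ω, ‖f ω‖ ^ 2 ∂P := integral_nonneg fun _ => sq_nonneg _
  rw [lpNorm_eq_integral_norm_rpow_toReal two_ne_zero ENNReal.ofNat_ne_top hf]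
  simp only [ENNReal.toReal_ofNat, Real.rpow_ofNat]
  rw [← Real.rpow_natCast, ← Real.rpow_mul h₀]
  norm_num

lemma measureReal_lt_norm_le {E : Type*} [NormedAddCommGroup E] [IsFiniteMeasure P] {f : Ω → E}
    (hf : MemLp f 2 P) {y : ℝ} (hy : 0 < y) (hD : lpNorm f 2 P ≤ D) :
    P.real {ω | y < ‖f ω‖} ≤ D ^ 2 / y ^ 2 := by
  have hMarkov := mul_meas_ge_le_integral_of_nonneg (μ := P) (f := fun ω => ‖f ω‖ ^ 2)
    (ae_of_all _ fun ω => sq_nonneg _) (hf.integrable_norm_pow two_ne_zero) (y ^ 2)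
  rw [← sq_lpNorm_two_eq hf.1] at hMarkov
  have hsub : P.real {ω | y < ‖f ω‖} ≤ P.real {ω | y ^ 2 ≤ ‖f ω‖ ^ 2} :=
    measureReal_mono fun ω (hω : y < _) => pow_le_pow_left₀ hy.le hω.le 2
  rw [le_div_iff₀ (by positivity), mul_comm]
  calc y ^ 2 * P.real {ω | y < ‖f ω‖} ≤ y ^ 2 * P.real {ω | y ^ 2 ≤ ‖f ω‖ ^ 2} := by gcongr
    _ ≤ lpNorm f 2 P ^ 2 := hMarkov
    _ ≤ D ^ 2 := pow_le_pow_left₀ lpNorm_nonneg hD 2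

namespace IsBoundedProcess

lemma mono {L' : ℝ} (hX : IsBoundedProcess P X L) (hL : L ≤ L') : IsBoundedProcess P X L' :=
  ⟨hX.measurable, hX.ae_norm_le.mono fun _ h k hk => (h k hk).trans hL⟩

variable [IsProbabilityMeasure P]

lemma nonneg (hX : IsBoundedProcess P X L) : 0 ≤ L := by
  obtain ⟨ω, hω⟩ := hX.ae_norm_le.exists
  exact (norm_nonneg _).trans (hω 1 le_rfl)

lemma memLp_segSum (hX : IsBoundedProcess P X L) {a b : ℕ} (ha : 1 ≤ a) (p : ENNReal) :
    MemLp (segSum X a b) p P := by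
  refine MemLp.of_bound (measurable_segSum hX.measurable ha).aestronglyMeasurable
    (((b + 1 - a : ℕ) : ℝ) * L) ?_
  filter_upwards [hX.ae_norm_le] with ω hω using norm_segSum_le hω ha

end IsBoundedProcess

end BoundedProcesses

section MaximalInequality

/-- The event that some partial sum of the segment `[a, b]` exceeds `t`. -/
def exceedSet {Ω : Type*} {d : ℕ} (X : ℕ → Ω → EuclideanSpace ℝ (Fin d)) (a b : ℕ) (t : ℝ) :
    Set Ω :=
  {ω | ∃ m ∈ Finset.Icc a b, t < ‖segSum X a m ω‖}

/-- The event that the partial sums starting at `a` first exceed `t` at time `m`. -/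
def firstPassage {Ω : Type*} {d : ℕ} (X : ℕ → Ω → EuclideanSpace ℝ (Fin d)) (a : ℕ) (t : ℝ)
    (m : ℕ) : Set Ω :=
  {ω | t < ‖segSum X a m ω‖ ∧ ∀ i ∈ Finset.Ico a m, ‖segSum X a i ω‖ ≤ t}

/-- The scale of the geometric tails of the maximal partial sum of a segment, when the terms are
bounded by `D` and the sums over the segment by `D` in `L²`. -/
def tailScale (n₀ : ℕ) (D : ℝ) : ℝ := (2 * n₀ + 11) * D

lemma tailScale_pos (n₀ : ℕ) {D : ℝ} (hD : 0 < D) : 0 < tailScale n₀ D := by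
  unfold tailScale
  positivity

variable {Ω : Type*} {d : ℕ} {X : ℕ → Ω → EuclideanSpace ℝ (Fin d)}

lemma exceedSet_eq_biUnion_firstPassage (a b : ℕ) (t : ℝ) :
    exceedSet X a b t = ⋃ m ∈ Finset.Icc a b, firstPassage X a t m := by
  classical
  ext ω
  simp only [exceedSet, firstPassage, Set.mem_ofPred_eq, Set.mem_iUnion, exists_prop]
  refine ⟨fun h => ⟨Nat.find h, (Nat.find_spec h).1, (Nat.find_spec h).2, fun i hi => ?_⟩,
    fun ⟨m, hm, h, _⟩ => ⟨m, hm, h⟩⟩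
  obtain ⟨hai, hi⟩ := Finset.mem_Ico.1 hi
  have hb := (Finset.mem_Icc.1 (Nat.find_spec h).1).2
  by_contra! hlt
  exact Nat.find_min h hi ⟨Finset.mem_Icc.2 ⟨hai, by lia⟩, hlt⟩

lemma pairwiseDisjoint_firstPassage (a b : ℕ) (t : ℝ) :
    ((Finset.Icc a b : Finset ℕ) : Set ℕ).PairwiseDisjoint (firstPassage X a t) := by
  have hlt : ∀ m ∈ Finset.Icc a b, ∀ n, m < n →
      Disjoint (firstPassage X a t m) (firstPassage X a t n) := fun m hm n hmn =>
    Set.disjoint_left.2 fun ω hωm hωn => hωm.1.not_ge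
      (hωn.2 m (Finset.mem_Ico.2 ⟨(Finset.mem_Icc.1 hm).1, hmn⟩))
  intro m hm n hn hmn
  rcases hmn.lt_or_gt with h | h
  · exact hlt m hm n h
  · exact (hlt n hn m h).symm

lemma measurableSet_firstPassage {a m : ℕ} (ha : 1 ≤ a) (t : ℝ) :
    MeasurableSet[pastSigma X m] (firstPassage X a t m) := by
  have hnorm : ∀ i, i ≤ m → Measurable[pastSigma X m] fun ω => ‖segSum X a i ω‖ := fun i hi =>
    measurable_norm.comp (measurable_segSum_pastSigma ha hi)
  have hinter : firstPassage X a t m = {ω | t < ‖segSum X a m ω‖} ∩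
      ⋂ i ∈ Finset.Ico a m, {ω | ‖segSum X a i ω‖ ≤ t} := by
    ext ω
    simp [firstPassage]
  rw [hinter]
  refine @MeasurableSet.inter _ (pastSigma X m) _ _ (hnorm m le_rfl measurableSet_Ioi) ?_
  exact Finset.measurableSet_biInter (m := pastSigma X m) _ fun i hi =>
    hnorm i (Finset.mem_Ico.1 hi).2.le measurableSet_Iic

lemma measurableSet_exceedSet {a b : ℕ} (t : ℝ) :
    MeasurableSet[futureSigma X a] (exceedSet X a b t) := by
  have hunion : exceedSet X a b t = ⋃ i ∈ Finset.Icc a b, {ω | t < ‖segSum X a i ω‖} := by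
    ext ω
    simp [exceedSet]
  rw [hunion]
  exact Finset.measurableSet_biUnion (m := futureSigma X a) _ fun i _ =>
    measurable_norm.comp (measurable_segSum_futureSigma le_rfl) measurableSet_Ioi

section Pathwise

variable {a b m n : ℕ} {t D : ℝ} {ω : Ω}

lemma lt_norm_segSum_of_lt_norm_segSum_of_norm_segSum_le (hω : ∀ k, 1 ≤ k → ‖X k ω‖ ≤ D)
    (hn : 1 ≤ n) (ham : a ≤ m + 1) (hmb : m ≤ b) (hm : t + (n + 2) * D < ‖segSum X a m ω‖)
    (hrest : ‖segSum X (m + n) b ω‖ ≤ 2 * D) : t < ‖segSum X a b ω‖ := by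
  have hgap := norm_segSum_sub_segSum_sub_segSum_le hω hn ham hmb
  have htriangle : ‖segSum X a m ω‖ ≤ ‖segSum X a b ω‖ +
      ‖segSum X a b ω - segSum X a m ω - segSum X (m + n) b ω‖ + ‖segSum X (m + n) b ω‖ := by
    refine le_trans (le_of_eq ?_) (norm_sub_le_of_le (norm_sub_le _ _) le_rfl)
    congr 1
    abel
  linarith

lemma norm_segSum_le_of_mem_firstPassage (hω : ∀ k, 1 ≤ k → ‖X k ω‖ ≤ D) (ht : 0 ≤ t)
    (ha : 1 ≤ a) (ham : a ≤ m) (hm : ω ∈ firstPassage X a t m) : ‖segSum X a m ω‖ ≤ t + D := by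
  rcases ham.eq_or_lt with rfl | hlt
  · rw [segSum_self]
    linarith [hω a ha]
  · obtain ⟨m, rfl⟩ := Nat.exists_eq_add_of_le' (ha.trans ham)
    rw [segSum_succ (by lia)]
    exact norm_add_le_of_le (hm.2 m (Finset.mem_Ico.2 ⟨by lia, m.lt_succ_self⟩)) (hω _ (by lia))

lemma exists_firstPassage_inter_exceedSet (hω : ∀ k, 1 ≤ k → ‖X k ω‖ ≤ D) (hn : 1 ≤ n)
    (ht : 0 ≤ t) (ha : 1 ≤ a) {y : ℝ} (hy : 0 ≤ y)
    (h : ω ∈ exceedSet X a b (t + (n + 1) * D + y)) :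
    ∃ m ∈ Finset.Icc a b, ω ∈ firstPassage X a t m ∩ exceedSet X (m + n) b y := by
  have hD : 0 ≤ D := (norm_nonneg _).trans (hω 1 le_rfl)
  obtain ⟨r, hr, hrt⟩ := h
  obtain ⟨har, hrb⟩ := Finset.mem_Icc.1 hr
  have hgapD : 0 ≤ (n + 1) * D := by positivity
  have hexceed : ω ∈ exceedSet X a b t := ⟨r, hr, by linarith⟩
  simp only [exceedSet_eq_biUnion_firstPassage, Set.mem_iUnion, exists_prop] at hexceed
  obtain ⟨m, hm, hpass⟩ := hexceed
  have ham := (Finset.mem_Icc.1 hm).1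
  have hmr : m ≤ r := by
    by_contra! hlt
    linarith [hpass.2 r (Finset.mem_Ico.2 ⟨har, hlt⟩)]
  have hpassage := norm_segSum_le_of_mem_firstPassage hω ht ha ham hpass
  have hgap := norm_segSum_sub_segSum_sub_segSum_le hω hn (show a ≤ m + 1 by lia) hmr
  have htriangle : ‖segSum X a r ω‖ ≤ ‖segSum X a r ω - segSum X a m ω - segSum X (m + n) r ω‖
      + ‖segSum X a m ω‖ + ‖segSum X (m + n) r ω‖ := by
    refine le_trans (le_of_eq ?_) norm_add₃_le
    congr 1
    abel
  have hy' : y < ‖segSum X (m + n) r ω‖ := by linarith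
  have hmnr : m + n ≤ r := by
    by_contra! hlt
    rw [segSum_of_lt hlt, Pi.zero_apply, norm_zero] at hy'
    linarith
  exact ⟨m, hm, hpass, r, Finset.mem_Icc.2 ⟨hmnr, hrb⟩, hy'⟩

end Pathwise

variable [MeasurableSpace Ω] {P : Measure Ω} [IsProbabilityMeasure P] {D t : ℝ} {n₀ a b : ℕ}

lemma measureReal_exceedSet (hX : ∀ k, 1 ≤ k → Measurable (X k)) (ha : 1 ≤ a) (t : ℝ) :
    P.real (exceedSet X a b t) = ∑ m ∈ Finset.Icc a b, P.real (firstPassage X a t m) := by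
  rw [exceedSet_eq_biUnion_firstPassage,
    measureReal_biUnion_finset (pairwiseDisjoint_firstPassage a b t)
      fun m _ => pastSigma_le hX m _ (measurableSet_firstPassage ha t)]

lemma measureReal_le_four_mul_inter (hX : IsBoundedProcess P X D)
    (hφ : phiCoeff P X n₀ < 1 / 2) (hD : 0 < D) {m : ℕ} (hm : 1 ≤ m)
    (hseg : lpNorm (segSum X (m + n₀) b) 2 P ≤ D) {A : Set Ω}
    (hA : MeasurableSet[pastSigma X m] A) :
    P.real A ≤ 4 * P.real (A ∩ {ω | ‖segSum X (m + n₀) b ω‖ ≤ 2 * D}) := by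
  set G : Set Ω := {ω | ‖segSum X (m + n₀) b ω‖ ≤ 2 * D} with hGdef
  have hG : MeasurableSet[futureSigma X (m + n₀)] G :=
    measurable_norm.comp (measurable_segSum_futureSigma le_rfl) measurableSet_Iic
  have hchebyshev : P.real Gᶜ ≤ D ^ 2 / (2 * D) ^ 2 := by
    have hcompl : Gᶜ = {ω | 2 * D < ‖segSum X (m + n₀) b ω‖} := by
      ext ω
      simp [hGdef]
    rw [hcompl]
    exact measureReal_lt_norm_le (hX.memLp_segSum (by lia) 2) (by positivity) hseg
  rw [probReal_compl_eq_one_sub (futureSigma_le hX.measurable (by lia) _ hG),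
    show D ^ 2 / (2 * D) ^ 2 = 1 / 4 by field_simp; norm_num] at hchebyshev
  have hmix := (abs_le.1 (abs_sub_le_phiCoeff_mul (P := P) hX.measurable hm hA hG)).1
  nlinarith [measureReal_nonneg (μ := P) (s := A)]

lemma measureReal_exceedSet_le_four_mul (hX : IsBoundedProcess P X D) (hn₀ : 1 ≤ n₀)
    (hφ : phiCoeff P X n₀ < 1 / 2) (hD : 0 < D) (ha : 1 ≤ a) (hseg : SegBound P X D a b) :
    P.real (exceedSet X a b (t + (n₀ + 2) * D)) ≤ 4 * P.real {ω | t < ‖segSum X a b ω‖} := by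
  set F := firstPassage X a (t + (n₀ + 2) * D)
  set G : ℕ → Set Ω := fun m => {ω | ‖segSum X (m + n₀) b ω‖ ≤ 2 * D}
  have hF : ∀ m, MeasurableSet[pastSigma X m] (F m) := fun m => measurableSet_firstPassage ha _
  have hG : ∀ m, MeasurableSet (G m) := fun m =>
    measurable_norm.comp (measurable_segSum hX.measurable (by lia)) measurableSet_Iic
  have hsub : P.real (⋃ m ∈ Finset.Icc a b, F m ∩ G m) ≤ P.real {ω | t < ‖segSum X a b ω‖} := by
    refine ENNReal.toReal_mono (measure_ne_top _ _) (measure_mono_ae ?_)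
    filter_upwards [hX.ae_norm_le] with ω hω h
    obtain ⟨m, hm, hFm, hGm⟩ : ∃ m ∈ Finset.Icc a b, ω ∈ F m ∩ G m := by
      simpa only [Set.mem_iUnion, exists_prop] using
        (show ω ∈ ⋃ m ∈ Finset.Icc a b, F m ∩ G m from h)
    obtain ⟨ham, hmb⟩ := Finset.mem_Icc.1 hm
    exact lt_norm_segSum_of_lt_norm_segSum_of_norm_segSum_le hω hn₀ (by lia) hmb hFm.1 hGm
  calc P.real (exceedSet X a b (t + (n₀ + 2) * D))
      = ∑ m ∈ Finset.Icc a b, P.real (F m) := measureReal_exceedSet hX.measurable ha _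
    _ ≤ ∑ m ∈ Finset.Icc a b, 4 * P.real (F m ∩ G m) := by
        refine Finset.sum_le_sum fun m hm => ?_
        have ham := (Finset.mem_Icc.1 hm).1
        exact measureReal_le_four_mul_inter hX hφ hD (ha.trans ham)
          (hseg _ _ (by lia) le_rfl) (hF m)
    _ = 4 * P.real (⋃ m ∈ Finset.Icc a b, F m ∩ G m) := by
        rw [← Finset.mul_sum, measureReal_biUnion_finset
          ((pairwiseDisjoint_firstPassage a b _).mono fun m => Set.inter_subset_left)
          fun m _ => (pastSigma_le hX.measurable m _ (hF m)).inter (hG m)]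
    _ ≤ 4 * P.real {ω | t < ‖segSum X a b ω‖} := by gcongr

lemma measureReal_inter_exceedSet_le (hX : IsBoundedProcess P X D) (hn₀ : 1 ≤ n₀)
    (hφ : phiCoeff P X n₀ < 1 / 2) (hD : 0 < D) {m : ℕ} (hm : 1 ≤ m)
    (hseg : SegBound P X D (m + n₀) b) {A : Set Ω} (hA : MeasurableSet[pastSigma X m] A) :
    P.real (A ∩ exceedSet X (m + n₀) b ((n₀ + 10) * D)) ≤ 3 / 4 * P.real A := by
  have hmax : P.real (exceedSet X (m + n₀) b ((n₀ + 10) * D)) ≤ 4 * (D ^ 2 / (8 * D) ^ 2) := by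
    rw [show ((n₀ : ℝ) + 10) * D = 8 * D + (n₀ + 2) * D by ring]
    refine (measureReal_exceedSet_le_four_mul hX hn₀ hφ hD (by lia) hseg).trans ?_
    gcongr
    exact measureReal_lt_norm_le (hX.memLp_segSum (by lia) 2) (by positivity)
      (hseg _ _ le_rfl le_rfl)
  rw [show D ^ 2 / (8 * D) ^ 2 = 1 / 64 by field_simp; norm_num] at hmax
  have hmix := (abs_le.1 (abs_sub_le_phiCoeff_mul (P := P) (k := n₀) hX.measurable hm hA
    (measurableSet_exceedSet (b := b) ((n₀ + 10) * D)))).2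
  nlinarith [measureReal_nonneg (μ := P) (s := A)]

lemma measureReal_exceedSet_add_tailScale_le (hX : IsBoundedProcess P X D) (hn₀ : 1 ≤ n₀)
    (hφ : phiCoeff P X n₀ < 1 / 2) (hD : 0 < D) (ha : 1 ≤ a) (hseg : SegBound P X D a b)
    (ht : 0 ≤ t) :
    P.real (exceedSet X a b (t + tailScale n₀ D)) ≤ 3 / 4 * P.real (exceedSet X a b t) := by
  set G : ℕ → Set Ω := fun m => exceedSet X (m + n₀) b ((n₀ + 10) * D)
  have hsub : P.real (exceedSet X a b (t + tailScale n₀ D))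
      ≤ P.real (⋃ m ∈ Finset.Icc a b, firstPassage X a t m ∩ G m) := by
    rw [show t + tailScale n₀ D = t + (n₀ + 1) * D + (n₀ + 10) * D by unfold tailScale; ring]
    refine ENNReal.toReal_mono (measure_ne_top _ _) (measure_mono_ae ?_)
    filter_upwards [hX.ae_norm_le] with ω hω h
    change ω ∈ ⋃ m ∈ Finset.Icc a b, firstPassage X a t m ∩ G m
    simpa only [Set.mem_iUnion, exists_prop] using
      exists_firstPassage_inter_exceedSet hω hn₀ ht ha (by positivity) h
  calc P.real (exceedSet X a b (t + tailScale n₀ D))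
      ≤ ∑ m ∈ Finset.Icc a b, P.real (firstPassage X a t m ∩ G m) :=
        hsub.trans (measureReal_biUnion_finset_le _ _)
    _ ≤ ∑ m ∈ Finset.Icc a b, 3 / 4 * P.real (firstPassage X a t m) := by
        refine Finset.sum_le_sum fun m hm => ?_
        have ham := (Finset.mem_Icc.1 hm).1
        exact measureReal_inter_exceedSet_le hX hn₀ hφ hD (ha.trans ham)
          (hseg.mono (by lia) le_rfl) (measurableSet_firstPassage ha t)
    _ = 3 / 4 * P.real (exceedSet X a b t) := by
        rw [measureReal_exceedSet hX.measurable ha, Finset.mul_sum]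

theorem measureReal_exceedSet_nat_mul_le (hX : IsBoundedProcess P X D) (hn₀ : 1 ≤ n₀)
    (hφ : phiCoeff P X n₀ < 1 / 2) (hD : 0 < D) (ha : 1 ≤ a) (hseg : SegBound P X D a b)
    (k : ℕ) : P.real (exceedSet X a b (k * tailScale n₀ D)) ≤ (3 / 4) ^ k := by
  induction k with
  | zero => simp
  | succ k ih =>
    have hstep := measureReal_exceedSet_add_tailScale_le hX hn₀ hφ hD ha hseg
      (mul_nonneg k.cast_nonneg (tailScale_pos n₀ hD).le)
    rw [Nat.cast_succ, add_one_mul, pow_succ]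
    linarith

end MaximalInequality

section QuadraticForms

variable {Ω : Type*} [MeasurableSpace Ω] {P : Measure Ω} {d : ℕ}
  {Y : Ω → EuclideanSpace ℝ (Fin d)} {u : EuclideanSpace ℝ (Fin d)}

lemma abs_inner_le_norm_of_norm_eq_one (hu : ‖u‖ = 1) (x : EuclideanSpace ℝ (Fin d)) :
    |inner ℝ x u| ≤ ‖x‖ := by
  simpa [hu] using abs_real_inner_le_norm x u

lemma lpNorm_inner_le (hY : MemLp Y 2 P) (hu : ‖u‖ = 1) :
    lpNorm (fun ω => inner ℝ (Y ω) u) 2 P ≤ lpNorm Y 2 P := by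
  rw [← lpNorm_norm hY.1]
  exact lpNorm_mono_real hY.norm fun ω => abs_inner_le_norm_of_norm_eq_one hu (Y ω)

lemma memLp_coord (hY : MemLp Y 2 P) (i : Fin d) : MemLp (fun ω => Y ω i) 2 P := by
  simpa [EuclideanSpace.inner_single_right] using
    hY.inner_const (𝕜 := ℝ) (EuclideanSpace.single i (1 : ℝ))

lemma integral_inner_eq_zero [IsFiniteMeasure P] (hY : MemLp Y 2 P) (hY₀ : ∫ ω, Y ω ∂P = 0)
    (u : EuclideanSpace ℝ (Fin d)) : ∫ ω, inner ℝ (Y ω) u ∂P = 0 := by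
  simp_rw [real_inner_comm u]
  rw [integral_inner (hY.integrable one_le_two), hY₀, inner_zero_right]

lemma sq_lpNorm_inner_eq_variance [IsFiniteMeasure P] (hY : MemLp Y 2 P)
    (hY₀ : ∫ ω, Y ω ∂P = 0) (u : EuclideanSpace ℝ (Fin d)) :
    lpNorm (fun ω => inner ℝ (Y ω) u) 2 P ^ 2 = Var[fun ω => inner ℝ (Y ω) u; P] := by
  have hinner := hY.inner_const (𝕜 := ℝ) u
  rw [sq_lpNorm_two_eq hinner.1, variance_of_integral_eq_zero hinner.1.aemeasurable
    (integral_inner_eq_zero hY hY₀ u)]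
  simp only [Real.norm_eq_abs, sq_abs]

variable [IsProbabilityMeasure P]

lemma variance_inner_eq_quadForm (hY : MemLp Y 2 P) (u : EuclideanSpace ℝ (Fin d)) :
    Var[fun ω => inner ℝ (Y ω) u; P] = quadForm (covMatrix P Y) u := by
  have hsum : (fun ω => inner ℝ (Y ω) u) = fun ω => ∑ i, u i * Y ω i := by
    ext ω
    simp [PiLp.inner_apply]
  rw [hsum, variance_fun_sum fun i => (memLp_coord hY i).const_mul (u i)]
  simp only [quadForm, PiLp.inner_apply, Matrix.toLpLin_apply, Matrix.mulVec, dotProduct,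
    covMatrix, Matrix.of_apply, covariance_const_mul_left, covariance_const_mul_right,
    RCLike.inner_apply, conj_trivial, Finset.mul_sum]
  exact Finset.sum_congr rfl fun i _ => Finset.sum_congr rfl fun j _ => by ring

lemma variance_inner_le_sq_lpNorm (hY : MemLp Y 2 P) (hu : ‖u‖ = 1) :
    Var[fun ω => inner ℝ (Y ω) u; P] ≤ lpNorm Y 2 P ^ 2 := by
  rw [sq_lpNorm_two_eq hY.1]
  refine (variance_le_expectation_sq (hY.inner_const u).1).trans ?_
  refine integral_mono_of_nonneg (ae_of_all _ fun ω => sq_nonneg _)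
    (hY.integrable_norm_pow two_ne_zero) (ae_of_all _ fun ω => ?_)
  exact sq_le_sq.2 (by simpa using abs_inner_le_norm_of_norm_eq_one hu (Y ω))

lemma quadForm_le_maxQuad (hY : MemLp Y 2 P) (hu : ‖u‖ = 1) :
    quadForm (covMatrix P Y) u ≤ maxQuad (covMatrix P Y) := by
  refine le_ciSup (f := fun u : Metric.sphere (0 : EuclideanSpace ℝ (Fin d)) 1 =>
    quadForm (covMatrix P Y) u) ⟨lpNorm Y 2 P ^ 2, ?_⟩ ⟨u, by simpa using hu⟩
  rintro _ ⟨v, rfl⟩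
  beta_reduce
  rw [← variance_inner_eq_quadForm hY]
  exact variance_inner_le_sq_lpNorm hY (by simp)

lemma minQuad_le_quadForm (hY : MemLp Y 2 P) (hu : ‖u‖ = 1) :
    minQuad (covMatrix P Y) ≤ quadForm (covMatrix P Y) u := by
  refine ciInf_le (f := fun u : Metric.sphere (0 : EuclideanSpace ℝ (Fin d)) 1 =>
    quadForm (covMatrix P Y) u) ⟨0, ?_⟩ ⟨u, by simpa using hu⟩
  rintro _ ⟨v, rfl⟩
  beta_reduce
  rw [← variance_inner_eq_quadForm hY]
  exact variance_nonneg _ _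

lemma le_minQuad (hd : 1 ≤ d) (hY : MemLp Y 2 P) {c : ℝ}
    (hc : ∀ u : EuclideanSpace ℝ (Fin d), ‖u‖ = 1 → c ≤ Var[fun ω => inner ℝ (Y ω) u; P]) :
    c ≤ minQuad (covMatrix P Y) := by
  have : Nonempty (Metric.sphere (0 : EuclideanSpace ℝ (Fin d)) 1) :=
    ⟨⟨EuclideanSpace.single ⟨0, hd⟩ 1, by simp⟩⟩
  refine le_ciInf fun u => ?_
  rw [← variance_inner_eq_quadForm hY]
  exact hc u (by simp)

lemma sq_lpNorm_le_mul_maxQuad (hY : MemLp Y 2 P) (hY₀ : ∫ ω, Y ω ∂P = 0) :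
    lpNorm Y 2 P ^ 2 ≤ d * maxQuad (covMatrix P Y) := by
  have hsum : lpNorm Y 2 P ^ 2
      = ∑ i, Var[fun ω => inner ℝ (Y ω) (EuclideanSpace.single i (1 : ℝ)); P] := by
    rw [sq_lpNorm_two_eq hY.1]
    simp_rw [EuclideanSpace.norm_sq_eq]
    rw [integral_finsetSum _ fun i _ => by simpa using (memLp_coord hY i).integrable_sq]
    refine Finset.sum_congr rfl fun i _ => ?_
    rw [variance_of_integral_eq_zero (hY.inner_const _).1.aemeasurable
      (integral_inner_eq_zero hY hY₀ _)]
    simp [EuclideanSpace.inner_single_right]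
  have hle : ∀ i ∈ Finset.univ, Var[fun ω => inner ℝ (Y ω) (EuclideanSpace.single i (1 : ℝ)); P]
      ≤ maxQuad (covMatrix P Y) := fun i _ => by
    rw [variance_inner_eq_quadForm hY]
    exact quadForm_le_maxQuad hY (by simp)
  simpa [hsum] using Finset.sum_le_card_nsmul _ _ _ hle

end QuadraticForms

section SegmentCovariance

variable {Ω : Type*} [MeasurableSpace Ω] {P : Measure Ω} {d : ℕ}
  {X : ℕ → Ω → EuclideanSpace ℝ (Fin d)}

lemma partialSum_eq_segSum (hmean : ∀ k, 1 ≤ k → ∫ ω, X k ω ∂P = 0) (n : ℕ) :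
    partialSum P X n = segSum X 1 n := by
  ext1 ω
  refine Finset.sum_congr rfl fun k hk => ?_
  rw [hmean k (Finset.mem_Icc.1 hk).1, sub_zero]

variable [IsProbabilityMeasure P] {L D : ℝ} {n₀ a b : ℕ}

lemma integral_segSum_eq_zero (hX : IsBoundedProcess P X L)
    (hmean : ∀ k, 1 ≤ k → ∫ ω, X k ω ∂P = 0) (ha : 1 ≤ a) : ∫ ω, segSum X a b ω ∂P = 0 := by
  unfold segSum
  rw [integral_finsetSum]
  · exact Finset.sum_eq_zero fun k hk => hmean k (ha.trans (Finset.mem_Icc.1 hk).1)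
  · intro k hk
    have hk₁ := ha.trans (Finset.mem_Icc.1 hk).1
    exact Integrable.of_bound (hX.measurable k hk₁).aestronglyMeasurable L
      (hX.ae_norm_le.mono fun ω h => h k hk₁)

lemma measureReal_nat_mul_lt_norm_segSum_le (hX : IsBoundedProcess P X D) (hn₀ : 1 ≤ n₀)
    (hφ : phiCoeff P X n₀ < 1 / 2) (hD : 0 < D) (ha : 1 ≤ a) (hseg : SegBound P X D a b)
    (k : ℕ) : P.real {ω | k * tailScale n₀ D < ‖segSum X a b ω‖} ≤ (3 / 4) ^ k := by
  refine (measureReal_mono fun ω hω => ?_).trans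
    (measureReal_exceedSet_nat_mul_le hX hn₀ hφ hD ha hseg k)
  refine ⟨b, Finset.mem_Icc.2 ⟨?_, le_rfl⟩, hω⟩
  by_contra! hlt
  have hscale := mul_nonneg k.cast_nonneg (tailScale_pos n₀ hD).le
  rw [Set.mem_ofPred_eq, segSum_of_lt hlt, Pi.zero_apply, norm_zero] at hω
  exact hω.not_ge hscale

lemma integral_inner_segSum_pow_four_le (hX : IsBoundedProcess P X D) (hn₀ : 1 ≤ n₀)
    (hφ : phiCoeff P X n₀ < 1 / 2) (hD : 0 < D) (ha : 1 ≤ a) (hseg : SegBound P X D a b)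
    {u : EuclideanSpace ℝ (Fin d)} (hu : ‖u‖ = 1) :
    ∫ ω, inner ℝ (segSum X a b ω) u ^ 4 ∂P ≤ (geomMoment 4 (3 / 4) * tailScale n₀ D) ^ 4 := by
  have hW := tailScale_pos n₀ hD
  have hκ : 1 ≤ geomMoment 4 (3 / 4) := one_le_geomMoment 4 (by norm_num) (by norm_num)
  have hmeas : Measurable fun ω => (inner ℝ (segSum X a b ω) u : ℝ) :=
    (measurable_segSum hX.measurable ha).inner_const
  have hmoment := integral_abs_pow_le_geomMoment_mul (P := P) hmeas hW (r := 3 / 4)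
    (by norm_num) (by norm_num) four_ne_zero fun k => (measureReal_mono fun ω hω =>
      lt_of_lt_of_le hω (abs_inner_le_norm_of_norm_eq_one hu (segSum X a b ω))).trans
      (measureReal_nat_mul_lt_norm_segSum_le hX hn₀ hφ hD ha hseg k)
  simp only [Even.pow_abs (show Even 4 by decide)] at hmoment
  rw [mul_pow]
  exact hmoment.trans (by gcongr; exact le_self_pow₀ hκ four_ne_zero)

theorem abs_covariance_inner_segSum_le (hX : IsBoundedProcess P X D) (hn₀ : 1 ≤ n₀)
    (hφ : phiCoeff P X n₀ < 1 / 2) (hD : 0 < D) {c e k : ℕ} {η : ℝ} (ha : 1 ≤ a) (hb : 1 ≤ b)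
    (hbc : b + k ≤ c) (hη : 0 < η) (hα : alphaCoeff P X k ≤ η ^ 3)
    (hab : SegBound P X D a b) (hce : SegBound P X D c e)
    {u : EuclideanSpace ℝ (Fin d)} (hu : ‖u‖ = 1) :
    |cov[fun ω => inner ℝ (segSum X a b ω) u, fun ω => inner ℝ (segSum X c e ω) u; P]|
      ≤ 6 * (geomMoment 4 (3 / 4) * tailScale n₀ D) ^ 2 * η := by
  have hc : 1 ≤ c := by lia
  have hM : 0 < geomMoment 4 (3 / 4) * tailScale n₀ D :=
    mul_pos (zero_lt_one.trans_le (one_le_geomMoment 4 (by norm_num) (by norm_num)))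
      (tailScale_pos n₀ hD)
  have hinner : Measurable fun x : EuclideanSpace ℝ (Fin d) => (inner ℝ x u : ℝ) := by fun_prop
  exact abs_covariance_le_of_integral_pow_four_le
    (pastSigma_le hX.measurable b) (futureSigma_le hX.measurable (by lia : 1 ≤ b + k)) hη
    (fun A B hA hB => (abs_sub_le_alphaCoeff hb hA hB).trans hα)
    (hinner.comp (measurable_segSum_pastSigma ha le_rfl)).stronglyMeasurable
    (hinner.comp (measurable_segSum_futureSigma hbc)).stronglyMeasurable
    ((hX.memLp_segSum ha 4).inner_const u) ((hX.memLp_segSum hc 4).inner_const u) hM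
    (integral_inner_segSum_pow_four_le hX hn₀ hφ hD ha hab hu)
    (integral_inner_segSum_pow_four_le hX hn₀ hφ hD hc hce hu)

end SegmentCovariance

lemma exists_greedy_blocks {N : ℕ → ℕ → ℝ} {A : ℝ} (h : ∀ a, 1 ≤ a → ∃ m, a ≤ m ∧ A ≤ N a m) :
    ∃ b : ℕ → ℕ, b 0 = 0 ∧ StrictMono b ∧ ∀ j, A ≤ N (b j + 1) (b (j + 1)) ∧
      ∀ m, b j + 1 ≤ m → m < b (j + 1) → N (b j + 1) m < A := by
  classical
  have hnext : ∀ p : ℕ, ∃ m, p + 1 ≤ m ∧ A ≤ N (p + 1) m := fun p => h _ (by lia)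
  let b : ℕ → ℕ := fun j => Nat.rec 0 (fun _ p => Nat.find (hnext p)) j
  have hfind : ∀ j, b (j + 1) = Nat.find (hnext (b j)) := fun j => rfl
  refine ⟨b, rfl, strictMono_nat_of_lt_succ fun j => ?_, fun j => ⟨?_, fun m hm hlt => ?_⟩⟩
  · exact hfind j ▸ (Nat.find_spec (hnext (b j))).1
  · exact hfind j ▸ (Nat.find_spec (hnext (b j))).2
  · by_contra! hle
    exact Nat.find_min (hnext (b j)) (hfind j ▸ hlt) ⟨hm, hle⟩

section Partition

variable {b : ℕ → ℕ}

lemma bddAbove_blockCount (hb : StrictMono b) (n : ℕ) : BddAbove {k : ℕ | 1 ≤ k ∧ b k ≤ n} :=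
  ⟨n, fun k hk => (hb.id_le k).trans hk.2⟩

lemma apply_blockCount_le (hb : StrictMono b) (hb₀ : b 0 = 0) (n : ℕ) :
    b (blockCount b n) ≤ n := by
  rcases Set.eq_empty_or_nonempty {k : ℕ | 1 ≤ k ∧ b k ≤ n} with hempty | hne
  · simp [blockCount, hempty, hb₀]
  · exact (Nat.sSup_mem hne (bddAbove_blockCount hb n)).2

lemma lt_apply_blockCount_add_one (hb : StrictMono b) (n : ℕ) : n < b (blockCount b n + 1) := by
  by_contra! hle
  have := le_csSup (bddAbove_blockCount hb n) ⟨Nat.le_add_left 1 _, hle⟩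
  exact absurd this (Nat.lt_succ_self (blockCount b n)).not_ge

lemma tendsto_blockCount (hb : StrictMono b) : Tendsto (blockCount b) atTop atTop := by
  refine tendsto_atTop.2 fun k => ?_
  filter_upwards [eventually_ge_atTop (b k)] with n hn
  exact Nat.lt_succ_iff.1 (hb.lt_iff_lt.1 (hn.trans_lt (lt_apply_blockCount_add_one hb n)))

lemma isBlockPartition_of_strictMono (hb : StrictMono b) (hb₀ : b 0 = 0) :
    IsBlockPartition (fun j => b (j - 1) + 1) b := by
  have hdisj : ∀ i j, i < j →
      Disjoint (Set.Icc (b (i - 1) + 1) (b i)) (Set.Icc (b (j - 1) + 1) (b j)) := by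
    intro i j hij
    refine Set.disjoint_left.2 fun x hxi hxj => ?_
    have hle : b i ≤ b (j - 1) := hb.monotone (by lia)
    exact absurd (hxj.1.trans (hxi.2.trans hle)) (Nat.lt_succ_self _).not_ge
  refine ⟨fun j hj => hb (by lia), fun j _ => Nat.lt_succ_self _, fun i j _ _ hij => ?_, ?_⟩
  · exact hij.lt_or_gt.elim (hdisj i j) fun hji => (hdisj j i hji).symm
  · ext n
    simp only [Set.mem_iUnion, Set.mem_Ici, Set.mem_Icc, exists_prop]
    refine ⟨fun ⟨j, _, hjn, _⟩ => by lia, fun hn => ⟨blockCount b (n - 1) + 1, by lia, ?_, ?_⟩⟩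
    · have := apply_blockCount_le hb hb₀ (n - 1)
      rw [Nat.add_sub_cancel]
      lia
    · have := lt_apply_blockCount_add_one hb (n - 1)
      lia

variable {Ω : Type*} {d : ℕ} (X : ℕ → Ω → EuclideanSpace ℝ (Fin d))

lemma sum_range_segSum_blocks (hb : StrictMono b) (hb₀ : b 0 = 0) (k : ℕ) (ω : Ω) :
    ∑ j ∈ Finset.range k, segSum X (b j + 1) (b (j + 1)) ω = segSum X 1 (b k) ω := by
  induction k with
  | zero => simp [hb₀, segSum]
  | succ k ih =>
    rw [Finset.sum_range_succ, ih]
    exact segSum_add_segSum (by lia) (hb.monotone k.le_succ) ω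

lemma sum_Icc_segSum_blocks (hb : StrictMono b) (hb₀ : b 0 = 0) (k : ℕ) (ω : Ω) :
    ∑ j ∈ Finset.Icc 1 k, segSum X (b (j - 1) + 1) (b j) ω = segSum X 1 (b k) ω := by
  rw [← sum_range_segSum_blocks X hb hb₀, ← Finset.Ico_add_one_right_eq_Icc,
    Finset.sum_Ico_eq_sum_range, Nat.add_sub_cancel]
  exact Finset.sum_congr rfl fun j _ => by rw [add_comm 1 j, Nat.add_sub_cancel]

end Partition

section SegmentNorms

variable {Ω : Type*} [MeasurableSpace Ω] {P : Measure Ω} [IsProbabilityMeasure P] {d : ℕ}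
  {X : ℕ → Ω → EuclideanSpace ℝ (Fin d)} {L : ℝ} {a m r : ℕ}

lemma lpNorm_segSum_le (hX : IsBoundedProcess P X L) (ha : 1 ≤ a) :
    lpNorm (segSum X a r) 2 P ≤ ((r + 1 - a : ℕ) : ℝ) * L := by
  have hmem := hX.memLp_segSum (b := r) ha 2
  have hL := hX.nonneg
  refine (sq_le_sq₀ lpNorm_nonneg (by positivity)).1 ?_
  rw [sq_lpNorm_two_eq hmem.1]
  refine (integral_mono_ae (hmem.integrable_norm_pow two_ne_zero)
    (integrable_const ((((r + 1 - a : ℕ) : ℝ) * L) ^ 2)) ?_).trans (by simp)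
  filter_upwards [hX.ae_norm_le] with ω hω
  exact pow_le_pow_left₀ (norm_nonneg _) (norm_segSum_le hω ha) 2

lemma lpNorm_segSum_le_add (hX : IsBoundedProcess P X L) (ha : 1 ≤ a) (ham : a ≤ m + 1)
    (hmr : m ≤ r) :
    lpNorm (segSum X a r) 2 P ≤ lpNorm (segSum X a m) 2 P + lpNorm (segSum X (m + 1) r) 2 P := by
  have hsplit : segSum X a r = segSum X a m + segSum X (m + 1) r :=
    funext fun ω => (segSum_add_segSum ham hmr ω).symm
  rw [hsplit]
  exact lpNorm_add_le (hX.memLp_segSum ha 2) one_le_two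

lemma lpNorm_segSum_add_one_le_add (hX : IsBoundedProcess P X L) (ha : 1 ≤ a) (ham : a ≤ m + 1)
    (hmr : m ≤ r) :
    lpNorm (segSum X (m + 1) r) 2 P ≤ lpNorm (segSum X a r) 2 P + lpNorm (segSum X a m) 2 P := by
  have hsplit : segSum X (m + 1) r = segSum X a r - segSum X a m :=
    funext fun ω => eq_sub_of_add_eq' (segSum_add_segSum ham hmr ω)
  rw [hsplit]
  exact lpNorm_sub_le (hX.memLp_segSum ha 2) one_le_two

lemma segBound_two_mul_of_lpNorm_le (hX : IsBoundedProcess P X L) {B : ℝ} (ha : 1 ≤ a)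
    (hB : ∀ m ≤ r, lpNorm (segSum X a m) 2 P ≤ B) : SegBound P X (2 * B) a r := by
  intro i j hi hj
  have hB₀ : 0 ≤ B := lpNorm_nonneg.trans (hB 0 r.zero_le)
  rcases lt_or_ge j i with hji | hij
  · rw [segSum_of_lt hji, lpNorm_zero]
    positivity
  · obtain ⟨m, rfl⟩ := Nat.exists_eq_add_of_le' (ha.trans hi)
    have hdiff := lpNorm_segSum_add_one_le_add hX ha hi (by lia : m ≤ j)
    linarith [hB j hj, hB m (by lia)]

lemma div_le_variance_inner_segSum (hX : IsBoundedProcess P X L)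
    (hmean : ∀ k, 1 ≤ k → ∫ ω, X k ω ∂P = 0) (hd : 1 ≤ d) {A C₂ : ℝ} (hA : 0 ≤ A) (hC₂ : 0 < C₂)
    (ha : 1 ≤ a)
    (hcomp : maxQuad (covMatrix P (segSum X a r)) ≤ C₂ * minQuad (covMatrix P (segSum X a r)))
    (hle : A ≤ lpNorm (segSum X a r) 2 P) {u : EuclideanSpace ℝ (Fin d)} (hu : ‖u‖ = 1) :
    A ^ 2 / (d * C₂) ≤ Var[fun ω => inner ℝ (segSum X a r ω) u; P] := by
  have hmem := hX.memLp_segSum (b := r) ha 2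
  have : (0 : ℝ) < d := by exact_mod_cast hd
  rw [variance_inner_eq_quadForm hmem, div_le_iff₀ (by positivity)]
  calc A ^ 2 ≤ lpNorm (segSum X a r) 2 P ^ 2 := pow_le_pow_left₀ hA hle 2
    _ ≤ d * maxQuad (covMatrix P (segSum X a r)) :=
      sq_lpNorm_le_mul_maxQuad hmem (integral_segSum_eq_zero hX hmean ha)
    _ ≤ d * (C₂ * minQuad (covMatrix P (segSum X a r))) := by gcongr
    _ ≤ d * (C₂ * quadForm (covMatrix P (segSum X a r)) u) := by
      gcongr
      exact minQuad_le_quadForm hmem hu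
    _ = quadForm (covMatrix P (segSum X a r)) u * (d * C₂) := by ring

lemma exists_le_lpNorm_segSum (hX : IsBoundedProcess P X L)
    (hmean : ∀ k, 1 ≤ k → ∫ ω, X k ω ∂P = 0) (hd : 1 ≤ d)
    (hs : Tendsto (fun n => minVar P X n) atTop atTop) (A : ℝ) (ha : 1 ≤ a) :
    ∃ m, a ≤ m ∧ A ≤ lpNorm (segSum X a m) 2 P := by
  obtain ⟨p, rfl⟩ := Nat.exists_eq_add_of_le' ha
  obtain ⟨m, ham, hlarge⟩ := ((eventually_ge_atTop (p + 1)).and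
    (hs.eventually_ge_atTop ((A + lpNorm (segSum X 1 p) 2 P) ^ 2))).exists
  have hminVar : minVar P X m ≤ lpNorm (segSum X 1 m) 2 P ^ 2 := by
    have hmem := hX.memLp_segSum (b := m) le_rfl 2
    have hunit : ‖EuclideanSpace.single (⟨0, hd⟩ : Fin d) (1 : ℝ)‖ = 1 := by simp
    rw [minVar, partialSum_eq_segSum hmean]
    refine (minQuad_le_quadForm hmem hunit).trans ?_
    rw [← variance_inner_eq_quadForm hmem]
    exact variance_inner_le_sq_lpNorm hmem hunit
  have habs := abs_le_of_sq_le_sq (hlarge.trans hminVar) lpNorm_nonneg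
  have hsplit := lpNorm_segSum_le_add hX le_rfl (by lia : 1 ≤ p + 1) (by lia : p ≤ m)
  exact ⟨m, ham, by linarith [le_abs_self (A + lpNorm (segSum X 1 p) 2 P)]⟩

end SegmentNorms

/-- Consecutive blocks `[b j + 1, b (j + 1)]`, `j = 0, 1, …`, covering the positive integers, all
of whose initial segment sums have `L²` norm at most `B`. The `j`-th block here is the block with
index `j + 1` in an `IsBlockPartition`. -/
structure IsBlocking {Ω : Type*} [MeasurableSpace Ω] (P : Measure Ω) {d : ℕ}
    (X : ℕ → Ω → EuclideanSpace ℝ (Fin d)) (B : ℝ) (b : ℕ → ℕ) : Prop where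
  zero : b 0 = 0
  strictMono : StrictMono b
  lpNorm_le : ∀ j, ∀ m ≤ b (j + 1), lpNorm (segSum X (b j + 1) m) 2 P ≤ B

/-- The constant in the covariance estimate for separated blocks, when the mixing coefficients
satisfy `α(k) ≤ (C ρ ^ k) ^ 3`. -/
noncomputable def mixingConst (n₀ : ℕ) (C : ℝ) : ℝ :=
  6 * (geomMoment 4 (3 / 4) * tailScale n₀ 2) ^ 2 * C

section Blocks

variable {Ω : Type*} [MeasurableSpace Ω] {P : Measure Ω} [IsProbabilityMeasure P] {d : ℕ}
  {X : ℕ → Ω → EuclideanSpace ℝ (Fin d)} {L B : ℝ} {b : ℕ → ℕ}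
  {u : EuclideanSpace ℝ (Fin d)}

lemma exists_isBlocking (hX : IsBoundedProcess P X L) {A : ℝ} (hA : 0 ≤ A)
    (hlarge : ∀ a, 1 ≤ a → ∃ m, a ≤ m ∧ A ≤ lpNorm (segSum X a m) 2 P) :
    ∃ b, IsBlocking P X (A + L) b ∧ ∀ j, A ≤ lpNorm (segSum X (b j + 1) (b (j + 1))) 2 P := by
  obtain ⟨b, hb₀, hb, hgreedy⟩ := exists_greedy_blocks hlarge
  refine ⟨b, ⟨hb₀, hb, fun j m hm => ?_⟩, fun j => (hgreedy j).1⟩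
  have hbefore : ∀ i < b (j + 1), lpNorm (segSum X (b j + 1) i) 2 P ≤ A := by
    intro i hi
    rcases lt_or_ge i (b j + 1) with hlt | hge
    · rwa [segSum_of_lt hlt, lpNorm_zero]
    · exact ((hgreedy j).2 i hge hi).le
  rcases hm.lt_or_eq with hlt | rfl
  · exact (hbefore m hlt).trans (le_add_of_nonneg_right hX.nonneg)
  · obtain ⟨p, hp⟩ := Nat.exists_eq_add_of_le' (Nat.one_le_of_lt (hb j.lt_succ_self))
    have hlast : lpNorm (segSum X (p + 1) (p + 1)) 2 P ≤ L := by
      simpa using lpNorm_segSum_le (P := P) (r := p + 1) hX (Nat.le_add_left 1 p)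
    have hbp : b j + 1 ≤ p + 1 := hp ▸ hb j.lt_succ_self
    rw [hp]
    exact (lpNorm_segSum_le_add hX (Nat.le_add_left 1 _) hbp p.le_succ).trans
      (add_le_add (hbefore p (by lia)) hlast)

namespace IsBlocking

lemma segBound (hb : IsBlocking P X B b) (hX : IsBoundedProcess P X L) (j : ℕ) :
    SegBound P X (2 * B) (b j + 1) (b (j + 1)) :=
  segBound_two_mul_of_lpNorm_le hX (Nat.le_add_left 1 _) (hb.lpNorm_le j)

lemma variance_inner_le (hb : IsBlocking P X B b) (hX : IsBoundedProcess P X L) (hu : ‖u‖ = 1)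
    {j m : ℕ} (hm : m ≤ b (j + 1)) :
    Var[fun ω => inner ℝ (segSum X (b j + 1) m ω) u; P] ≤ B ^ 2 :=
  (variance_inner_le_sq_lpNorm (hX.memLp_segSum (Nat.le_add_left 1 _) 2) hu).trans
    (pow_le_pow_left₀ lpNorm_nonneg (hb.lpNorm_le j m hm) 2)

end IsBlocking

section Covariances

variable {n₀ ℓ : ℕ} {C ρ : ℝ}

lemma abs_covariance_inner_segSum_le_mul_pow (hX : IsBoundedProcess P X (2 * B)) (hn₀ : 1 ≤ n₀)
    (hφ : phiCoeff P X n₀ < 1 / 2) (hB : 0 < B) (hC : 0 < C) (hρ : 0 < ρ)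
    (hα : ∀ k, 1 ≤ k → alphaCoeff P X k ≤ (C * ρ ^ k) ^ 3) {a r c e k : ℕ} (ha : 1 ≤ a)
    (hr : 1 ≤ r) (hk : 1 ≤ k) (hrc : r + k ≤ c) (har : SegBound P X (2 * B) a r)
    (hce : SegBound P X (2 * B) c e) (hu : ‖u‖ = 1) :
    |cov[fun ω => inner ℝ (segSum X a r ω) u, fun ω => inner ℝ (segSum X c e ω) u; P]|
      ≤ mixingConst n₀ C * B ^ 2 * ρ ^ k := by
  refine (abs_covariance_inner_segSum_le hX hn₀ hφ (by positivity) ha hr hrc (by positivity)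
    (hα k hk) har hce hu).trans_eq ?_
  simp only [mixingConst, tailScale]
  ring

lemma IsBlocking.abs_covariance_succ_le (hb : IsBlocking P X B b) (hX : IsBoundedProcess P X L)
    (hLB : L ≤ 2 * B) (hn₀ : 1 ≤ n₀) (hφ : phiCoeff P X n₀ < 1 / 2) (hB : 0 < B) (hC : 0 < C)
    (hρ : 0 < ρ) (hα : ∀ k, 1 ≤ k → alphaCoeff P X k ≤ (C * ρ ^ k) ^ 3) (hℓ : 1 ≤ ℓ)
    (hlen : ∀ j, b j + ℓ < b (j + 1)) (hu : ‖u‖ = 1) (i : ℕ) :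
    |cov[fun ω => inner ℝ (segSum X (b i + 1) (b (i + 1)) ω) u,
      fun ω => inner ℝ (segSum X (b (i + 1) + 1) (b (i + 1 + 1)) ω) u; P]|
      ≤ ℓ * L * B + mixingConst n₀ C * B ^ 2 * ρ ^ ℓ := by
  -- The last `ℓ` terms of the block are split off, so that the rest is at distance `ℓ` from the
  -- next block.
  obtain ⟨r, hr⟩ := Nat.exists_eq_add_of_le' (le_of_add_le_right (hlen i).le)
  have hir : b i < r := by have := hlen i; lia
  have hmem : ∀ {j m : ℕ}, MemLp (fun ω => (inner ℝ (segSum X (j + 1) m ω) u : ℝ)) 2 P :=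
    (hX.memLp_segSum (Nat.le_add_left 1 _) 2).inner_const u
  have hsplit : (fun ω => (inner ℝ (segSum X (b i + 1) (b (i + 1)) ω) u : ℝ))
      = (fun ω => inner ℝ (segSum X (r + 1) (b (i + 1)) ω) u)
        + fun ω => inner ℝ (segSum X (b i + 1) r ω) u := by
    ext ω
    rw [Pi.add_apply, ← inner_add_left, add_comm (segSum X (r + 1) _ ω), segSum_add_segSum (by lia)
      (by lia)]
  have htail : Var[fun ω => inner ℝ (segSum X (r + 1) (b (i + 1)) ω) u; P] ≤ (ℓ * L) ^ 2 := by
    refine (variance_inner_le_sq_lpNorm (hX.memLp_segSum (Nat.le_add_left 1 _) 2) hu).trans ?_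
    have hcard : b (i + 1) + 1 - (r + 1) = ℓ := by lia
    simpa [hcard] using pow_le_pow_left₀ lpNorm_nonneg
      (lpNorm_segSum_le (P := P) (r := b (i + 1)) hX (Nat.le_add_left 1 r)) 2
  rw [hsplit, covariance_add_left hmem hmem hmem]
  refine (abs_add_le _ _).trans (add_le_add ?_ ?_)
  · exact abs_covariance_le_mul_of_variance_le_sq hmem hmem (mul_nonneg ℓ.cast_nonneg hX.nonneg)
      hB.le htail (hb.variance_inner_le hX hu le_rfl)
  · exact abs_covariance_inner_segSum_le_mul_pow (hX.mono hLB) hn₀ hφ hB hC hρ hα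
      (Nat.le_add_left 1 _) (by lia) hℓ (by lia) ((hb.segBound hX i).mono le_rfl (by lia))
      (hb.segBound hX (i + 1)) hu

lemma add_mul_add_one_le (hlen : ∀ j, b j + ℓ < b (j + 1)) (i q : ℕ) :
    b i + q * (ℓ + 1) ≤ b (i + q) := by
  induction q with
  | zero => simp
  | succ q ih =>
    have := hlen (i + q)
    rw [← add_assoc]
    linarith

lemma IsBlocking.abs_covariance_le (hb : IsBlocking P X B b) (hX : IsBoundedProcess P X L)
    (hLB : L ≤ 2 * B) (hn₀ : 1 ≤ n₀) (hφ : phiCoeff P X n₀ < 1 / 2) (hB : 0 < B) (hC : 0 < C)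
    (hρ : 0 < ρ) (hα : ∀ k, 1 ≤ k → alphaCoeff P X k ≤ (C * ρ ^ k) ^ 3) (hℓ : 1 ≤ ℓ)
    (hlen : ∀ j, b j + ℓ < b (j + 1)) (hu : ‖u‖ = 1) (i q : ℕ) :
    |cov[fun ω => inner ℝ (segSum X (b i + 1) (b (i + 1)) ω) u,
      fun ω => inner ℝ (segSum X (b (i + q + 1) + 1) (b (i + q + 1 + 1)) ω) u; P]|
      ≤ (if q = 0 then ℓ * L * B else 0) + mixingConst n₀ C * B ^ 2 * ρ ^ ℓ * ρ ^ q := by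
  rcases Nat.eq_zero_or_pos q with rfl | hq
  · simpa using hb.abs_covariance_succ_le hX hLB hn₀ hφ hB hC hρ hα hℓ hlen hu i
  · have hgap : b (i + 1) + (ℓ + q) ≤ b (i + q + 1) + 1 := by
      have := add_mul_add_one_le hlen (i + 1) q
      rw [add_right_comm i 1 q] at this
      nlinarith
    rw [if_neg hq.ne', zero_add, mul_assoc, ← pow_add]
    exact abs_covariance_inner_segSum_le_mul_pow (hX.mono hLB) hn₀ hφ hB hC hρ hα
      (Nat.le_add_left 1 _) (Nat.one_le_of_lt (hb.strictMono i.lt_succ_self))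
      (by lia) hgap (hb.segBound hX i) (hb.segBound hX (i + q + 1)) hu

end Covariances

section Variances

variable {v : ℝ}

lemma IsBlocking.variance_inner_segSum_bounds (hb : IsBlocking P X B b)
    (hX : IsBoundedProcess P X L) (hu : ‖u‖ = 1)
    (hv : ∀ j, v ≤ Var[fun ω => inner ℝ (segSum X (b j + 1) (b (j + 1)) ω) u; P])
    {β : ℕ → ℝ} (hβ : ∀ n, ∑ q ∈ Finset.range n, β q ≤ v / 4)
    (hcov : ∀ i q, |cov[fun ω => inner ℝ (segSum X (b i + 1) (b (i + 1)) ω) u,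
      fun ω => inner ℝ (segSum X (b (i + q + 1) + 1) (b (i + q + 1 + 1)) ω) u; P]| ≤ β q)
    (k : ℕ) :
    v / 2 * k ≤ Var[fun ω => inner ℝ (segSum X 1 (b k) ω) u; P] ∧
      Var[fun ω => inner ℝ (segSum X 1 (b k) ω) u; P] ≤ (B ^ 2 + v / 2) * k := by
  have hsum := abs_le.1 (abs_variance_sum_sub_sum_variance_le
    (fun j => (hX.memLp_segSum (Nat.le_add_left 1 (b j)) 2).inner_const u) hβ hcov k)
  simp_rw [← sum_inner, sum_range_segSum_blocks X hb.strictMono hb.zero] at hsum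
  have hlower := Finset.card_nsmul_le_sum (Finset.range k) _ _ fun j _ => hv j
  have hupper := Finset.sum_le_card_nsmul (Finset.range k) _ _ fun j _ =>
    hb.variance_inner_le hX hu (le_refl (b (j + 1)))
  simp only [Finset.card_range, nsmul_eq_mul] at hlower hupper
  constructor <;> linarith [hsum.1, hsum.2]

end Variances

end Blocks

section Parameters

lemma exists_mul_pow_le_mul_pow_cube {δ : ℝ} (hδ₀ : 0 < δ) (hδ₁ : δ < 1) (C : ℝ) :
    ∃ C' ρ : ℝ, 0 < C' ∧ 0 < ρ ∧ ρ < 1 ∧ ∀ n : ℕ, C * δ ^ n ≤ (C' * ρ ^ n) ^ 3 := by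
  have hroot : (δ ^ (1 / 3 : ℝ)) ^ 3 = δ := by
    rw [← Real.rpow_natCast, ← Real.rpow_mul hδ₀.le]
    norm_num
  refine ⟨max C 1, δ ^ (1 / 3 : ℝ), by positivity, by positivity,
    Real.rpow_lt_one hδ₀.le hδ₁ (by norm_num), fun n => ?_⟩
  have hC : C ≤ max C 1 ^ 3 :=
    (le_max_left C 1).trans (le_self_pow₀ (le_max_right C 1) three_ne_zero)
  rw [mul_pow, pow_right_comm, hroot]
  gcongr

lemma sum_range_ite_add_mul_pow_le {x y ρ : ℝ} (hx : 0 ≤ x) (hy : 0 ≤ y) (hρ₀ : 0 ≤ ρ)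
    (hρ₁ : ρ < 1) (n : ℕ) :
    ∑ q ∈ Finset.range n, ((if q = 0 then x else 0) + y * ρ ^ q) ≤ x + y * (1 - ρ)⁻¹ := by
  have hfirst : ∑ q ∈ Finset.range n, (if q = 0 then x else 0) ≤ x := by
    rw [Finset.sum_ite_eq']
    split_ifs <;> simp [hx]
  have hgeom : ∑ q ∈ Finset.range n, ρ ^ q ≤ (1 - ρ)⁻¹ := by
    rw [← tsum_geometric_of_lt_one hρ₀ hρ₁]
    exact (summable_geometric_of_lt_one hρ₀ hρ₁).sum_le_tsum _ fun q _ => by positivity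
  rw [Finset.sum_add_distrib, ← Finset.mul_sum]
  gcongr

-- With `A = ℓ² L` and `B = A + L ≤ 2 A`, the left side is at most `(2 / ℓ + O(ρ ^ ℓ)) A²`.
lemma exists_block_length {K ρ η L : ℝ} (c : ℝ) (hK : 0 ≤ K) (hρ₀ : 0 ≤ ρ) (hρ₁ : ρ < 1)
    (hη : 0 < η) (hL : 0 ≤ L) :
    ∃ ℓ : ℕ, 2 ≤ ℓ ∧ c ≤ ℓ ∧ ℓ * L * (ℓ ^ 2 * L + L)
      + K * (ℓ ^ 2 * L + L) ^ 2 * ρ ^ ℓ * (1 - ρ)⁻¹ ≤ η * (ℓ ^ 2 * L) ^ 2 := by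
  have : 0 ≤ (1 - ρ)⁻¹ := inv_nonneg.2 (sub_nonneg.2 hρ₁.le)
  have hlim : Tendsto (fun ℓ : ℕ => 2 / (ℓ : ℝ) + 4 * K * (1 - ρ)⁻¹ * ρ ^ ℓ) atTop (nhds 0) := by
    simpa using (tendsto_const_div_atTop_nhds_zero_nat 2).add
      ((tendsto_pow_atTop_nhds_zero_of_lt_one hρ₀ hρ₁).const_mul (4 * K * (1 - ρ)⁻¹))
  obtain ⟨ℓ, hℓ, hc, hsmall⟩ := ((eventually_ge_atTop 2).and
    ((tendsto_natCast_atTop_atTop.eventually_ge_atTop c).and (hlim.eventually_le_const hη))).exists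
  refine ⟨ℓ, hℓ, hc, ?_⟩
  have hℓ' : (2 : ℝ) ≤ ℓ := by exact_mod_cast hℓ
  have hB : ℓ ^ 2 * L + L ≤ 2 * (ℓ ^ 2 * L) := by
    rw [two_mul]
    gcongr
    exact le_mul_of_one_le_left hL (one_le_pow₀ (by linarith))
  calc ℓ * L * (ℓ ^ 2 * L + L) + K * (ℓ ^ 2 * L + L) ^ 2 * ρ ^ ℓ * (1 - ρ)⁻¹
      ≤ ℓ * L * (2 * (ℓ ^ 2 * L)) + K * (2 * (ℓ ^ 2 * L)) ^ 2 * ρ ^ ℓ * (1 - ρ)⁻¹ := by gcongr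
    _ = (2 / (ℓ : ℝ) + 4 * K * (1 - ρ)⁻¹ * ρ ^ ℓ) * (ℓ ^ 2 * L) ^ 2 := by field_simp; ring
    _ ≤ η * (ℓ ^ 2 * L) ^ 2 := by gcongr

end Parameters

section Existence

variable {Ω : Type*} [MeasurableSpace Ω] {P : Measure Ω} {d : ℕ}
  {X : ℕ → Ω → EuclideanSpace ℝ (Fin d)} {L : ℝ}

lemma exists_isBoundedProcess (hmeas : ∀ k, 1 ≤ k → Measurable (X k))
    (hbdd : ∃ L : ℝ, ∀ k, 1 ≤ k → ∀ᵐ ω ∂P, ‖X k ω‖ ≤ L) :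
    ∃ L, 1 ≤ L ∧ IsBoundedProcess P X L := by
  obtain ⟨L, hL⟩ := hbdd
  refine ⟨max L 1, le_max_right L 1, hmeas, ?_⟩
  simp only [ae_all_iff]
  exact fun k hk => (hL k hk).mono fun ω hω => hω.trans (le_max_left L 1)

variable [IsProbabilityMeasure P]

lemma add_le_of_mul_le_lpNorm_segSum (hX : IsBoundedProcess P X L) (hL : 0 < L) {a r N : ℕ}
    (har : a ≤ r) (hN : N * L ≤ lpNorm (segSum X (a + 1) r) 2 P) : a + N ≤ r := by
  have hle := hN.trans (lpNorm_segSum_le hX (Nat.le_add_left 1 a))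
  have : N ≤ r + 1 - (a + 1) := by exact_mod_cast le_of_mul_le_mul_right hle hL
  lia

lemma exists_isBlocking_of_threshold (hX : IsBoundedProcess P X L) (hL : 0 < L) (hd : 1 ≤ d)
    (hmean : ∀ k, 1 ≤ k → ∫ ω, X k ω ∂P = 0)
    (hs : Tendsto (fun n => minVar P X n) atTop atTop) {C₁ C₂ : ℝ} (hC₂ : 0 < C₂)
    (hcomp : ∀ n m : ℕ, 1 ≤ n → n ≤ m → C₁ ≤ lpNorm (segSum X n m) 2 P →
      maxQuad (covMatrix P (segSum X n m)) ≤ C₂ * minQuad (covMatrix P (segSum X n m)))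
    {N : ℕ} (hN : C₁ ≤ N * L) :
    ∃ b, IsBlocking P X (N * L + L) b ∧ (∀ j, b j + N ≤ b (j + 1)) ∧
      ∀ j (u : EuclideanSpace ℝ (Fin d)), ‖u‖ = 1 →
        (N * L) ^ 2 / (d * C₂) ≤ Var[fun ω => inner ℝ (segSum X (b j + 1) (b (j + 1)) ω) u; P] := by
  have hA : 0 ≤ N * L := by positivity
  obtain ⟨b, hb, hlarge⟩ := exists_isBlocking hX hA fun a ha =>
    exists_le_lpNorm_segSum hX hmean hd hs (N * L) ha
  have hlt : ∀ j, b j < b (j + 1) := fun j => hb.strictMono j.lt_succ_self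
  exact ⟨b, hb, fun j => add_le_of_mul_le_lpNorm_segSum hX hL (hlt j).le (hlarge j),
    fun j u hu => div_le_variance_inner_segSum hX hmean hd hA hC₂ (Nat.le_add_left 1 _)
      (hcomp _ _ (Nat.le_add_left 1 _) (hlt j) (hN.trans (hlarge j))) (hlarge j) hu⟩

theorem exists_isBlocking_variance_bounds (hX : IsBoundedProcess P X L) (hL : 1 ≤ L)
    (hd : 1 ≤ d) (hmean : ∀ k, 1 ≤ k → ∫ ω, X k ω ∂P = 0)
    (hα : ∃ C δ : ℝ, 0 < C ∧ 0 < δ ∧ δ < 1 ∧ ∀ n : ℕ, 1 ≤ n → alphaCoeff P X n ≤ C * δ ^ n)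
    {n₀ : ℕ} (hn₀ : 1 ≤ n₀) (hφ : phiCoeff P X n₀ < 1 / 2) (hcov : ComparableEigenvalues P X)
    (hs : Tendsto (fun n => minVar P X n) atTop atTop) :
    ∃ B v b, L ≤ B ∧ 0 < v ∧ IsBlocking P X B b ∧
      (∀ j (u : EuclideanSpace ℝ (Fin d)), ‖u‖ = 1 →
        v ≤ Var[fun ω => inner ℝ (segSum X (b j + 1) (b (j + 1)) ω) u; P]) ∧
      ∀ k (u : EuclideanSpace ℝ (Fin d)), ‖u‖ = 1 →
        v / 2 * k ≤ Var[fun ω => inner ℝ (segSum X 1 (b k) ω) u; P] ∧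
        Var[fun ω => inner ℝ (segSum X 1 (b k) ω) u; P] ≤ (B ^ 2 + v / 2) * k := by
  obtain ⟨C₀, δ, -, hδ₀, hδ₁, hαδ⟩ := hα
  obtain ⟨C₁, C₂, -, hC₂, hcomp⟩ := hcov
  obtain ⟨C, ρ, hC, hρ₀, hρ₁, hcube⟩ := exists_mul_pow_le_mul_pow_cube hδ₀ hδ₁ C₀
  have hL₀ : 0 < L := one_pos.trans_le hL
  have hK : 0 ≤ mixingConst n₀ C := by unfold mixingConst; positivity
  obtain ⟨ℓ, hℓ, hC₁ℓ, hsmall⟩ := exists_block_length (η := 1 / (4 * (d * C₂))) C₁ hK hρ₀.le hρ₁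
    (by positivity) hL₀.le
  have hℓ' : (2 : ℝ) ≤ ℓ := by exact_mod_cast hℓ
  obtain ⟨b, hb, hlen, hv⟩ := exists_isBlocking_of_threshold hX hL₀ hd hmean hs (by positivity)
    hcomp (N := ℓ ^ 2) (by push_cast; nlinarith)
  push_cast at hb hv
  set B : ℝ := ℓ ^ 2 * L + L
  have hLB : L ≤ B := le_add_of_nonneg_left (by positivity)
  have hB : 0 < B := hL₀.trans_le hLB
  refine ⟨B, (ℓ ^ 2 * L) ^ 2 / (d * C₂), b, hLB, by positivity, hb, hv, fun k u hu => ?_⟩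
  refine hb.variance_inner_segSum_bounds hX hu (fun j => hv j u hu) (fun n => ?_)
    (hb.abs_covariance_le (ℓ := ℓ) hX (by linarith) hn₀ hφ hB hC hρ₀
      (fun k hk => (hαδ k hk).trans (hcube k)) (by lia) (fun j => ?_) hu) k
  · refine (sum_range_ite_add_mul_pow_le (by positivity) (by positivity) hρ₀.le hρ₁ n).trans
      (hsmall.trans_eq ?_)
    field_simp
  · have := hlen j
    nlinarith

end Existence

section Conclusions

variable {Ω : Type*} [MeasurableSpace Ω] {P : Measure Ω} {d : ℕ}
  {X : ℕ → Ω → EuclideanSpace ℝ (Fin d)} {L B v : ℝ} {b : ℕ → ℕ}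

lemma partialSum_sub_sum_segSum_blocks (hmean : ∀ k, 1 ≤ k → ∫ ω, X k ω ∂P = 0)
    (hb : StrictMono b) (hb₀ : b 0 = 0) (n : ℕ) (ω : Ω) :
    partialSum P X n ω - ∑ j ∈ Finset.Icc 1 (blockCount b n), segSum X (b (j - 1) + 1) (b j) ω
      = segSum X (b (blockCount b n) + 1) n ω := by
  rw [partialSum_eq_segSum hmean, sum_Icc_segSum_blocks X hb hb₀, sub_eq_iff_eq_add',
    segSum_add_segSum (by lia) (apply_blockCount_le hb hb₀ n)]

variable [IsProbabilityMeasure P]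

namespace IsBlocking

lemma sqrt_le_lpNorm_inner_and_lpNorm_inner_le (hb : IsBlocking P X B b)
    (hX : IsBoundedProcess P X L) (hmean : ∀ k, 1 ≤ k → ∫ ω, X k ω ∂P = 0)
    (hv : ∀ j (u : EuclideanSpace ℝ (Fin d)), ‖u‖ = 1 →
      v ≤ Var[fun ω => inner ℝ (segSum X (b j + 1) (b (j + 1)) ω) u; P])
    {j : ℕ} (hj : 1 ≤ j) {u : EuclideanSpace ℝ (Fin d)} (hu : ‖u‖ = 1) :
    √v ≤ lpNorm (fun ω => inner ℝ (segSum X (b (j - 1) + 1) (b j) ω) u) 2 P ∧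
      ∀ m ∈ Finset.Icc (b (j - 1) + 1) (b j),
        lpNorm (fun ω => inner ℝ (segSum X (b (j - 1) + 1) m ω) u) 2 P ≤ B := by
  obtain ⟨j, rfl⟩ := Nat.exists_eq_add_of_le' hj
  rw [Nat.add_sub_cancel]
  have hmem : ∀ m, MemLp (segSum X (b j + 1) m) 2 P := fun m =>
    hX.memLp_segSum (Nat.le_add_left 1 _) 2
  refine ⟨Real.sqrt_le_iff.2 ⟨lpNorm_nonneg, ?_⟩, fun m hm =>
    (lpNorm_inner_le (hmem m) hu).trans (hb.lpNorm_le j m (Finset.mem_Icc.1 hm).2)⟩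
  rw [sq_lpNorm_inner_eq_variance (hmem _)
    (integral_segSum_eq_zero hX hmean (Nat.le_add_left 1 _))]
  exact hv j u hu

lemma lpNorm_segSum_le_two_mul (hb : IsBlocking P X B b) (hX : IsBoundedProcess P X L) {i j : ℕ}
    (hj : 1 ≤ j) (hi : i ∈ Finset.Icc (b (j - 1) + 1) (b j)) :
    lpNorm (segSum X i (b j)) 2 P ≤ 2 * B := by
  obtain ⟨j, rfl⟩ := Nat.exists_eq_add_of_le' hj
  exact hb.segBound hX j i _ (Finset.mem_Icc.1 hi).1 le_rfl

lemma eventually_variance_inner_segSum_bounds (hb : IsBlocking P X B b)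
    (hX : IsBoundedProcess P X L) (hv : 0 < v) {V : ℝ}
    (hvar : ∀ k (u : EuclideanSpace ℝ (Fin d)), ‖u‖ = 1 →
      v * k ≤ Var[fun ω => inner ℝ (segSum X 1 (b k) ω) u; P] ∧
      Var[fun ω => inner ℝ (segSum X 1 (b k) ω) u; P] ≤ V * k) :
    ∀ᶠ n in atTop, ∀ u : EuclideanSpace ℝ (Fin d), ‖u‖ = 1 →
      v / 4 * blockCount b n ≤ Var[fun ω => inner ℝ (segSum X 1 n ω) u; P] ∧
      Var[fun ω => inner ℝ (segSum X 1 n ω) u; P] ≤ 2 * (V + B ^ 2) * blockCount b n := by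
  have hcount := tendsto_natCast_atTop_atTop (R := ℝ).comp (tendsto_blockCount hb.strictMono)
  filter_upwards [hcount.eventually_ge_atTop 1, hcount.eventually_ge_atTop (4 * B ^ 2 / v)]
    with n hone hlarge u hu
  rw [Function.comp_apply] at hone hlarge
  rw [div_le_iff₀ hv] at hlarge
  have hle := apply_blockCount_le hb.strictMono hb.zero n
  have hmem : ∀ {a m : ℕ}, MemLp (fun ω => (inner ℝ (segSum X (a + 1) m ω) u : ℝ)) 2 P :=
    (hX.memLp_segSum (Nat.le_add_left 1 _) 2).inner_const u
  have hsplit : (fun ω => (inner ℝ (segSum X 1 n ω) u : ℝ))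
      = (fun ω => inner ℝ (segSum X 1 (b (blockCount b n)) ω) u)
        + fun ω => inner ℝ (segSum X (b (blockCount b n) + 1) n ω) u := by
    ext ω
    rw [Pi.add_apply, ← inner_add_left, segSum_add_segSum (by lia) hle]
  have hrest := hb.variance_inner_le hX hu (lt_apply_blockCount_add_one hb.strictMono n).le
  have hblocks := hvar (blockCount b n) u hu
  have hlower := half_variance_sub_le_variance_add (P := P)
    (hmem (a := 0) (m := b (blockCount b n))) (hmem (a := b (blockCount b n)) (m := n))
  have hupper := variance_add_le_two_mul_add (P := P)
    (hmem (a := 0) (m := b (blockCount b n))) (hmem (a := b (blockCount b n)) (m := n))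
  rw [zero_add, ← hsplit] at hlower hupper
  constructor
  · linarith
  · nlinarith [sq_nonneg B]

lemma ae_isLittleO_segSum_blockCount (hb : IsBlocking P X B b) (hX : IsBoundedProcess P X L)
    (hLB : L ≤ 2 * B) (hB : 0 < B) {n₀ : ℕ} (hn₀ : 1 ≤ n₀) (hφ : phiCoeff P X n₀ < 1 / 2)
    {ε : ℝ} (hε : 0 < ε) :
    ∀ᵐ ω ∂P, (fun n => segSum X (b (blockCount b n) + 1) n ω)
      =o[atTop] fun n => ((blockCount b n : ℝ) + 1) ^ ε := by
  have hW := tailScale_pos n₀ (mul_pos two_pos hB)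
  have hcount := tendsto_blockCount hb.strictMono
  have hexceed := ae_eventually_notMem_of_measureReal_le_pow (P := P) (r := 3 / 4) (by norm_num)
    (by norm_num) fun j k => measureReal_exceedSet_nat_mul_le (hX.mono hLB) hn₀ hφ (by positivity)
      (Nat.le_add_left 1 _) (hb.segBound hX j) k
  filter_upwards [hexceed] with ω hω
  refine IsBigO.trans_isLittleO (IsBigO.of_bound (tailScale n₀ (2 * B)) ?_)
    ((isLittleO_ceil_mul_log_rpow (2 / -Real.log (3 / 4)) hε).comp_tendsto hcount)
  filter_upwards [hcount.eventually hω] with n hn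
  rw [Function.comp_apply, Real.norm_of_nonneg (by positivity), mul_comm]
  rcases lt_or_ge n (b (blockCount b n) + 1) with hlt | hge
  · rw [segSum_of_lt hlt, Pi.zero_apply, norm_zero]
    positivity
  · by_contra! hlt
    exact hn ⟨n, Finset.mem_Icc.2 ⟨hge, (lt_apply_blockCount_add_one hb.strictMono n).le⟩, hlt⟩

end IsBlocking

lemma isBigO_add_one_minVar (hX : IsBoundedProcess P X L) (hd : 1 ≤ d)
    (hmean : ∀ k, 1 ≤ k → ∫ ω, X k ω ∂P = 0) {k : ℕ → ℕ} (hk : Tendsto k atTop atTop)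
    {R : ℝ} (hR : 0 < R)
    (hvar : ∀ᶠ n in atTop, ∀ u : EuclideanSpace ℝ (Fin d), ‖u‖ = 1 →
      R * k n ≤ Var[fun ω => inner ℝ (segSum X 1 n ω) u; P]) :
    (fun n => (k n : ℝ) + 1) =O[atTop] fun n => minVar P X n := by
  refine IsBigO.of_bound (2 / R) ?_
  filter_upwards [hvar, hk.eventually_ge_atTop 1] with n hn hone
  have hone' : (1 : ℝ) ≤ k n := by exact_mod_cast hone
  have hle : R * k n ≤ minVar P X n := by
    rw [minVar, partialSum_eq_segSum hmean]
    exact le_minQuad hd (hX.memLp_segSum le_rfl 2) hn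
  rw [Real.norm_of_nonneg (by positivity), Real.norm_of_nonneg (hle.trans' (by positivity)),
    div_mul_eq_mul_div, le_div_iff₀ hR]
  nlinarith

end Conclusions

end BlockASIP

theorem mainTheorem3 {Ω : Type*} [MeasurableSpace Ω] (P : Measure Ω) [IsProbabilityMeasure P]
    {d : ℕ} (hd : 1 ≤ d) (X : ℕ → Ω → EuclideanSpace ℝ (Fin d))
    (hmeas : ∀ k, 1 ≤ k → Measurable (X k))
    (hbdd : ∃ L : ℝ, ∀ k, 1 ≤ k → ∀ᵐ ω ∂P, ‖X k ω‖ ≤ L)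
    (hmean : ∀ k, 1 ≤ k → ∫ ω, X k ω ∂P = 0)
    (hα : ∃ C δ : ℝ, 0 < C ∧ 0 < δ ∧ δ < 1 ∧ ∀ n : ℕ, 1 ≤ n → alphaCoeff P X n ≤ C * δ ^ n)
    (hφ : ∃ n₀ : ℕ, 1 ≤ n₀ ∧ phiCoeff P X n₀ < 1 / 2)
    (hcov : ComparableEigenvalues P X)
    (hs : Tendsto (fun n => minVar P X n) atTop atTop) :
    ∃ A₁ A₂ : ℝ, 0 < A₁ ∧ 0 < A₂ ∧ ∃ a b : ℕ → ℕ, IsBlockPartition a b ∧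
      (∀ j, 1 ≤ j → ∀ u : EuclideanSpace ℝ (Fin d), ‖u‖ = 1 →
        A₁ ≤ lpNorm (fun ω => inner ℝ (segSum X (a j) (b j) ω) u) 2 P ∧
        ∀ m ∈ Finset.Icc (a j) (b j),
          lpNorm (fun ω => inner ℝ (segSum X (a j) m ω) u) 2 P ≤ A₂) ∧
      (∃ c : ℝ, 0 < c ∧ ∀ j, 1 ≤ j → ∀ i ∈ Finset.Icc (a j) (b j),
        lpNorm (segSum X i (b j)) 2 P ≤ c) ∧
      (∃ R₁ R₂ : ℝ, 0 < R₁ ∧ 0 < R₂ ∧ ∀ᶠ n in atTop,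
        ∀ u : EuclideanSpace ℝ (Fin d), ‖u‖ = 1 →
          R₁ * (blockCount b n : ℝ) ≤ variance (fun ω => inner ℝ (partialSum P X n ω) u) P ∧
          variance (fun ω => inner ℝ (partialSum P X n ω) u) P
            = quadForm (covMatrix P (partialSum P X n)) u ∧
          variance (fun ω => inner ℝ (partialSum P X n ω) u) P ≤ R₂ * (blockCount b n : ℝ)) ∧
      (∀ ε : ℝ, 0 < ε → ∀ᵐ ω ∂P,
        (fun n : ℕ => partialSum P X n ω
            - ∑ j ∈ Finset.Icc 1 (blockCount b n), segSum X (a j) (b j) ω)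
          =o[atTop] fun n : ℕ => minVar P X n ^ ε) := by
  obtain ⟨n₀, hn₀, hφ⟩ := hφ
  obtain ⟨L, hL, hX⟩ := exists_isBoundedProcess hmeas hbdd
  obtain ⟨B, v, b, hLB, hv, hb, hblock, hvar⟩ :=
    exists_isBlocking_variance_bounds hX hL hd hmean hα hn₀ hφ hcov hs
  have hB : 0 < B := by linarith
  have hbounds := hb.eventually_variance_inner_segSum_bounds hX (half_pos hv) hvar
  refine ⟨√v, B, Real.sqrt_pos.2 hv, hB, fun j => b (j - 1) + 1, b,
    isBlockPartition_of_strictMono hb.strictMono hb.zero,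
    fun j hj u hu => hb.sqrt_le_lpNorm_inner_and_lpNorm_inner_le hX hmean hblock hj hu,
    ⟨2 * B, by positivity, fun j hj i hi => hb.lpNorm_segSum_le_two_mul hX hj hi⟩,
    ⟨v / 2 / 4, 2 * (B ^ 2 + v / 2 + B ^ 2), by positivity, by positivity, ?_⟩, fun ε hε => ?_⟩
  · filter_upwards [hbounds] with n hn u hu
    rw [partialSum_eq_segSum hmean]
    exact ⟨(hn u hu).1, variance_inner_eq_quadForm (hX.memLp_segSum le_rfl 2) u, (hn u hu).2⟩
  · have hcount : (fun n => (blockCount b n : ℝ) + 1) =O[atTop] fun n => minVar P X n :=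
      isBigO_add_one_minVar hX hd hmean (tendsto_blockCount hb.strictMono) (by positivity)
        (hbounds.mono fun n hn u hu => (hn u hu).1)
    filter_upwards [hb.ae_isLittleO_segSum_blockCount hX (by linarith) hB hn₀ hφ hε] with ω hω
    simp only [partialSum_sub_sum_segSum_blocks hmean hb.strictMono hb.zero]
    exact hω.trans_isBigO (hcount.rpow hε.le (hs.eventually_ge_atTop 0))
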